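/- Consider a $K$-armed bandit over the epochs $t=1,\dots,T$. Pulling arm $k$ at epoch $t$ yields the reward $Y_{k,t}=\mu_{k,t}+\epsilon_t$, where $\mu_{k,t}\in[0,1]$ and $\epsilon_1,\dots,\epsilon_T$ are independent sub-Gaussian random variables with parameter $\sigma>0$, i.e. $\mathbb E[e^{\lambda\epsilon_t}]\le e^{\sigma^2\lambda^2/2}$ for all $\lambda\in\mathbb R$. Suppose that all arms share a known period $T_1\ge 1$, that is $\mu_{k,t+T_1}=\mu_{k,t}$ for all $k,t$, and that one arm is best at every phase: there is an arm $k$ with $\mu_{k,t}=\max_{k'}\mu_{k',t}$ for $t=1,\dots,T_1$. A policy chooses the arm $\pi_t$ from the previously pulled arms and observed rewards; its expected regret is $\mathbb E[R_T^\pi]=\mathbb E\big[\sum_{t=1}^T(\max_k\mu_{k,t}-\mu_{\pi_t,t})\big]$. The sequential-elimination policy has inputs $T,K,\sigma,T_1$ and works as follows. Set $\mathcal A_1=\{1,\dots,K\}$. In round $s=1,2,\dots$ let $n_s=\big\lceil 2^{2+2s}\log(KTs^2)/T_1\big\rceil\,T_1$; pull each arm of $\mathcal A_s$ exactly $n_s$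 times, one arm after the other, each in a block of $n_s$ consecutive epochs, in any order of the arms fixed in advance for each $s$ and $\mathcal A_s$; let $m_k^{(s)}$ be the average of the rewards obtained from arm $k$ in this round; and set $\mathcal A_{s+1}=\{k\in\mathcal A_s:\ m_k^{(s)}\ge\max_{k'\in\mathcal A_s}m_{k'}^{(s)}-2^{-s}\sigma\}$. The policy is stopped after epoch $T$. (Upper bound) For every $\sigma>0$ there is a constant $C>0$, depending only on $\sigma$, such that for all $K,T,T_1\ge1$ with $T_1\le\sqrt{T/K}$ and for all mean rewards and noise as above, the sequential-elimination policy is an admissible (measurable) policy with $$\mathbb E[R_T^\pi]\le C\sqrt{TK}\,(1+\log T),$$ so that its expected regret is $\tilde O(\sqrt{TK})$. (Lower bound) For every $\sigma>0$ there is a constant $c>0$, depending only on $\sigma$, such that for all $K\ge2$, $T\ge K$ and $T_1\ge1$, every policy (possibly randomized, and possibly using knowledge of $K,T,\sigma,T_1$), when the noise variables are independent with law $N(0,\sigma^2)$, there are mean rewards $\mu_{k,t}\in[0,1]$ of the above kind, with a fixed best arm and all arms having minimum period exactly $T_1$, for which $$\mathbb E[R_T^\pi]\ge c\sqrt{TK}.$$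 -/

import Mathlib

open MeasureTheory ProbabilityTheory
open scoped NNReal

namespace PeriodicBandit

noncomputable section

/-- Mean rewards: `μ k t` is the mean reward of arm `k` at epoch `t`, for epochs `t = 1, 2, …`. -/
abbrev Means (K : ℕ) := Fin K → ℕ → ℝ

/-- A (non-randomized) policy: `π t h` is the arm pulled at epoch `t + 1`, as a function of the
`t` pairs (arm pulled, reward observed) seen so far; the entry `h i` belongs to epoch `i + 1`. -/
abbrev Policy (K : ℕ) := (t : ℕ) → (Fin t → Fin K × ℝ) → Fin K

/-- The history of the first `t` epochs when `π` is run with mean rewards `μ` and the noise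
realization `e`: pulling arm `k` at epoch `t` yields the reward `μ k t + e t`. -/
def history {K : ℕ} (π : Policy K) (μ : Means K) (e : ℕ → ℝ) : (t : ℕ) → Fin t → Fin K × ℝ
  | 0 => Fin.elim0
  | t + 1 =>
    let h := history π μ e t
    Fin.snoc (α := fun _ => Fin K × ℝ) h (π t h, μ (π t h) (t + 1) + e (t + 1))

/-- The arm pulled at epoch `t + 1`. -/
def pulledArm {K : ℕ} (π : Policy K) (μ : Means K) (e : ℕ → ℝ) (t : ℕ) : Fin K :=
  π t (history π μ e t)

/-- The pseudo-regret over the epochs `1, …, T`. -/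
def pseudoRegret {K : ℕ} (π : Policy K) (μ : Means K) (T : ℕ) (e : ℕ → ℝ) : ℝ :=
  ∑ t ∈ Finset.range T, ((⨆ k, μ k (t + 1)) - μ (pulledArm π μ e t) (t + 1))

/-- The expected regret over the epochs `1, …, T` when the noise is `ε`. -/
def expectedRegret {K : ℕ} (π : Policy K) (μ : Means K) (T : ℕ)
    {Ω : Type*} [MeasurableSpace Ω] (P : Measure Ω) (ε : ℕ → Ω → ℝ) : ℝ :=
  ∫ ω, pseudoRegret π μ T (fun t => ε t ω) ∂P

/-- All arms have mean rewards in `[0, 1]` that repeat after `T₁ ≥ 1` epochs, and one fixed arm is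
best at every phase of the period. -/
structure IsFixedBestPeriodic {K : ℕ} (T₁ : ℕ) (μ : Means K) : Prop where
  pos : 0 < T₁
  mem_Icc : ∀ k t, μ k t ∈ Set.Icc (0 : ℝ) 1
  periodic : ∀ k t, μ k (t + T₁) = μ k t
  best : ∃ k, ∀ t ∈ Finset.Icc 1 T₁, ∀ k', μ k' t ≤ μ k t

/-- No arm has a positive period smaller than `T₁`. -/
def NoSmallerPeriod {K : ℕ} (T₁ : ℕ) (μ : Means K) : Prop :=
  ∀ k, ∀ p, 0 < p → (∀ t, μ k (t + p) = μ k t) → T₁ ≤ p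

/-- The noise variables of the epochs `1, …, T` are independent and sub-Gaussian with parameter `σ`,
that is `𝔼 exp (l ε_t) ≤ exp (σ² l² / 2)` for all real `l`. This entails that they have mean zero
and satisfy `ℙ (|ε_t| > x) ≤ 2 exp (-x² / (2 σ²))`. -/
structure IsSubGaussianNoise (T : ℕ) (σ : ℝ≥0) {Ω : Type*} [MeasurableSpace Ω]
    (P : Measure Ω) (ε : ℕ → Ω → ℝ) : Prop where
  measurable : ∀ t ∈ Finset.Icc 1 T, Measurable (ε t)
  indep : iIndepFun (fun t : Finset.Icc 1 T => ε t) P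
  subGaussian : ∀ t ∈ Finset.Icc 1 T, HasSubgaussianMGF (ε t) (σ ^ 2) P

/-- The noise variables of the epochs `1, …, T` are independent with law `N(0, σ²)`. -/
structure IsGaussianNoise (T : ℕ) (σ : ℝ≥0) {Ω : Type*} [MeasurableSpace Ω]
    (P : Measure Ω) (ε : ℕ → Ω → ℝ) : Prop where
  measurable : ∀ t ∈ Finset.Icc 1 T, Measurable (ε t)
  indep : iIndepFun (fun t : Finset.Icc 1 T => ε t) P
  law : ∀ t ∈ Finset.Icc 1 T, P.map (ε t) = gaussianReal 0 (σ ^ 2)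

/-! ### Sequential elimination -/

/-- The number `n_s` of pulls of each active arm in round `s`; a multiple of `T₁`. -/
def roundPulls (K T T₁ s : ℕ) : ℕ :=
  ⌈(2 : ℝ) ^ (2 + 2 * s) * Real.log (K * T * (s : ℝ) ^ 2) / T₁⌉₊ * T₁

/-- The order in which the active arms of a round are pulled: `order s A` lists each element of `A`
exactly once. -/
def IsPullOrder {K : ℕ} (order : ℕ → Finset (Fin K) → List (Fin K)) : Prop :=
  ∀ s A, (order s A).Nodup ∧ (order s A).toFinset = A

/-- The average reward of arm `k` in round `s`, when this round starts after `b` epochs with the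
active set `A`. The arms are pulled `n_s` times each, in consecutive blocks that follow
`order s A`; `y i` is the reward of epoch `i + 1`. -/
def roundMean {K : ℕ} (T T₁ : ℕ) (order : ℕ → Finset (Fin K) → List (Fin K)) (y : ℕ → ℝ)
    (s b : ℕ) (A : Finset (Fin K)) (k : Fin K) : ℝ :=
  let n := roundPulls K T T₁ s
  (∑ i ∈ Finset.range n, y (b + (order s A).idxOf k * n + i)) / n

open Classical in
/-- `roundState … y r` is the pair (number of epochs used by rounds `1, …, r`,
active set `A_{r+1}`), when the rewards of the epochs `1, 2, …` are `y 0, y 1, …`. -/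
def roundState {K : ℕ} (T T₁ : ℕ) (σ : ℝ) (order : ℕ → Finset (Fin K) → List (Fin K))
    (y : ℕ → ℝ) : ℕ → ℕ × Finset (Fin K)
  | 0 => (0, Finset.univ)
  | r + 1 =>
    let b := (roundState T T₁ σ order y r).1
    let A := (roundState T T₁ σ order y r).2
    let m := roundMean T T₁ order y (r + 1) b A
    (b + A.card * roundPulls K T T₁ (r + 1),
      A.filter fun k => ∀ k' ∈ A, m k' - (2 : ℝ)⁻¹ ^ (r + 1) * σ ≤ m k)

open Classical in
/-- The sequential-elimination policy with inputs `T`, `K`, `σ` and `T₁`. After `t` epochs it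
determines the current round `r + 1` and pulls the arm whose block contains epoch `t + 1`.
Rewards not yet observed are replaced by `0`; they have no influence, since the start and the
active set of the current round are functions of the first `t` rewards. -/
def seqElim {K : ℕ} [NeZero K] (T T₁ : ℕ) (σ : ℝ)
    (order : ℕ → Finset (Fin K) → List (Fin K)) : Policy K := fun t h =>
  let y : ℕ → ℝ := fun i => if hi : i < t then (h ⟨i, hi⟩).2 else 0
  let st := roundState T T₁ σ order y
  if hr : ∃ r, (st r).1 ≤ t ∧ t < (st (r + 1)).1 then
    let r := Nat.find hr
    (order (r + 1) (st r).2).getD ((t - (st r).1) / roundPulls K T T₁ (r + 1)) 0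
  else 0

end

end PeriodicBandit

/-! Upper bound. A block of `n_s` pulls covers whole periods, so the mean part of its average reward
is the average of the arm over one period (`phaseMean`), wherever the block starts. Only noise then
separates the comparison of two arms from that of their phase means. The difference of two block
sums is sub-Gaussian with parameter `2 n σ²`, and the logarithm in `n_s` makes it exceed `n 2^{-s}
σ` with probability at most `2/(K T s²)`. A union over arms and rounds leaves a bad event of
probability at most `4/T` (`measure_not_goodNoise_le`), which adds at most `4` to the expected
regret. The start and the active set of a round are random, but they depend on earlier noise only:
on each of their possible values, past and future noise are independent
(`measure_runState_inter_badRound`).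

Outside the bad event the best arm survives and every arm left after `r ≥ 1` rounds has gap at most
`2 · 2^{-r} σ` (`GoodNoise.gap_le`). The regret is then at most the sum over rounds of duration
times gap bound, plus `T₁` for the block cut off at `T` (`GoodNoise.exists_pseudoRegret_le`). Rounds
with `2^r ≥ √(T/K)` have gaps of order `√(K/T)` and cost at most `O(T √(K/T))` together; the shorter
earlier rounds cost a geometric sum (`sum_mul_gapBound_le`).

Lower bound. Start from means that are equal for all arms, with a spike at the multiples of `T₁`
that fixes the minimum period. Some arm `j` is pulled at most `T/K` times on average. Give `j` a
constant bonus `Δ` of order `√(K/T)`. Only pulls of `j` reveal the change, so the divergence between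
the two bandits is `Δ²/(2σ²)` times the expected number of those pulls. It is too small to push the
pulls of `j` above `11T/16` (`integral_history_change_means_le`), and every other pull costs `Δ`. -/

namespace PeriodicBandit

/-! ### Dependence of the history on the noise; measurability and independence -/

section History

variable {K : ℕ}

/-- The noise realization with the entries outside `1, …, T` replaced by `0`. -/
def truncNoise (T : ℕ) (e : ℕ → ℝ) (t : ℕ) : ℝ := if t ∈ Finset.Icc 1 T then e t else 0

theorem truncNoise_of_mem {T t : ℕ} (e : ℕ → ℝ) (h1 : 1 ≤ t) (hT : t ≤ T) :
    truncNoise T e t = e t := by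
  simp [truncNoise, h1, hT]

theorem history_congr (π : Policy K) (μ : Means K) {e e' : ℕ → ℝ} {t : ℕ}
    (h : ∀ i, 1 ≤ i → i ≤ t → e i = e' i) : history π μ e t = history π μ e' t := by
  induction t with
  | zero => rfl
  | succ t ih =>
    have := ih fun i h1 h2 => h i h1 (by omega)
    simp only [history, this, h (t + 1) (by omega) le_rfl]

theorem pulledArm_congr (π : Policy K) (μ : Means K) {e e' : ℕ → ℝ} {t : ℕ}
    (h : ∀ i, 1 ≤ i → i ≤ t → e i = e' i) : pulledArm π μ e t = pulledArm π μ e' t := by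
  simp only [pulledArm, history_congr π μ h]

theorem history_apply (π : Policy K) (μ : Means K) (e : ℕ → ℝ) {t i : ℕ} (hi : i < t) :
    history π μ e t ⟨i, hi⟩ =
      (pulledArm π μ e i, μ (pulledArm π μ e i) (i + 1) + e (i + 1)) := by
  induction t with
  | zero => omega
  | succ t ih =>
    rcases Nat.lt_succ_iff_lt_or_eq.1 hi with h | rfl
    · have : (⟨i, hi⟩ : Fin (t + 1)) = Fin.castSucc ⟨i, h⟩ := rfl
      rw [this, history, Fin.snoc_castSucc, ih h]
    · have : (⟨i, hi⟩ : Fin (i + 1)) = Fin.last i := rfl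
      rw [this, history, Fin.snoc_last]
      rfl

theorem measurable_snoc {α β : Type*} [MeasurableSpace α] [MeasurableSpace β] {t : ℕ}
    {f : α → Fin t → β} {g : α → β} (hf : Measurable f) (hg : Measurable g) :
    Measurable fun a => (Fin.snoc (α := fun _ => β) (f a) (g a) : Fin (t + 1) → β) := by
  refine measurable_pi_iff.2 fun i => ?_
  refine Fin.lastCases ?_ (fun j => ?_) i
  · simpa using hg
  · simpa using measurable_pi_iff.1 hf j

theorem measurable_history {S : Type*} [MeasurableSpace S] {π : S → Policy K}
    (hπ : ∀ t, Measurable fun x : S × (Fin t → Fin K × ℝ) => π x.1 t x.2) (μ : Means K)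
    (t : ℕ) : Measurable fun x : S × (ℕ → ℝ) => history (π x.1) μ x.2 t := by
  induction t with
  | zero => exact measurable_const
  | succ t ih =>
    have hp : Measurable fun x : S × (ℕ → ℝ) => π x.1 t (history (π x.1) μ x.2 t) :=
      (hπ t).comp (measurable_fst.prodMk ih)
    refine measurable_snoc ih (hp.prodMk (Measurable.add ?_ ?_))
    · exact (measurable_of_countable fun k => μ k (t + 1)).comp hp
    · exact (measurable_pi_apply _).comp measurable_snd

theorem measurable_pulledArm {S : Type*} [MeasurableSpace S] {π : S → Policy K}
    (hπ : ∀ t, Measurable fun x : S × (Fin t → Fin K × ℝ) => π x.1 t x.2) (μ : Means K)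
    (t : ℕ) : Measurable fun x : S × (ℕ → ℝ) => pulledArm (π x.1) μ x.2 t :=
  (hπ t).comp (measurable_fst.prodMk (measurable_history hπ μ t))

/-- Nothing is assumed about the noise after epoch `T`, not even measurability. Replacing it by `0`
gives a measurable random sequence that produces the same run up to `T`. -/
theorem measurable_truncNoise {Ω : Type*} [MeasurableSpace Ω] {T : ℕ} {ε : ℕ → Ω → ℝ}
    (h : ∀ t ∈ Finset.Icc 1 T, Measurable (ε t)) :
    Measurable fun ω => truncNoise T fun t => ε t ω := by
  refine measurable_pi_iff.2 fun t => ?_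
  by_cases ht : t ∈ Finset.Icc 1 T
  · simpa only [truncNoise, if_pos ht] using h t ht
  · simp only [truncNoise, if_neg ht]
    exact measurable_const

/-- The noise realization with the entries outside `b + 1, …, T` replaced by `0`. -/
def tailNoise (b T : ℕ) (e : ℕ → ℝ) (t : ℕ) : ℝ := if t ∈ Finset.Icc (b + 1) T then e t else 0

/-- This is the form in which independence enters both bounds: a functional of the noise up to `b`
against a functional of the noise after `b`. -/
theorem indepFun_truncNoise_tailNoise {Ω : Type*} [MeasurableSpace Ω] {P : Measure Ω} {T b : ℕ}
    {ε : ℕ → Ω → ℝ} (hm : ∀ t ∈ Finset.Icc 1 T, Measurable (ε t))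
    (hi : iIndepFun (fun t : Finset.Icc 1 T => ε t) P) (hb : b ≤ T) :
    IndepFun (fun ω => truncNoise b fun t => ε t ω) (fun ω => tailNoise b T fun t => ε t ω) P := by
  classical
  let S : Finset (Finset.Icc 1 T) := Finset.univ.filter fun t => (t : ℕ) ≤ b
  let S' : Finset (Finset.Icc 1 T) := Finset.univ.filter fun t => b + 1 ≤ (t : ℕ)
  have hd : Disjoint S S' := by
    rw [Finset.disjoint_left]
    intro x hx hx'
    simp only [S, S', Finset.mem_filter] at hx hx'
    omega
  -- Extension by zero from a subfamily of the epochs to a full sequence; both truncations factor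
  -- through it.
  let ext (U : Finset (Finset.Icc 1 T)) (x : U → ℝ) (t : ℕ) : ℝ :=
    if h : ∃ h : t ∈ Finset.Icc 1 T, (⟨t, h⟩ : Finset.Icc 1 T) ∈ U then x ⟨⟨t, h.1⟩, h.2⟩ else 0
  have hext (U) : Measurable (ext U) := by
    refine measurable_pi_iff.2 fun t => ?_
    by_cases h : ∃ h : t ∈ Finset.Icc 1 T, (⟨t, h⟩ : Finset.Icc 1 T) ∈ U
    · simp only [ext, dif_pos h]
      exact measurable_pi_apply _
    · simp only [ext, dif_neg h]
      exact measurable_const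
  have key := (hi.indepFun_finset S S' hd fun t => hm t t.2).comp (hext S) (hext S')
  convert key using 1
  · funext ω t
    simp only [truncNoise, Function.comp, ext, S, Finset.mem_Icc, Finset.mem_filter,
      Finset.mem_univ, true_and, exists_prop]
    by_cases h : 1 ≤ t ∧ t ≤ b
    · rw [if_pos h, dif_pos ⟨⟨h.1, h.2.trans hb⟩, h.2⟩]
    · rw [if_neg h, dif_neg (by tauto)]
  · funext ω t
    simp only [tailNoise, Function.comp, ext, S', Finset.mem_Icc, Finset.mem_filter,
      Finset.mem_univ, true_and, exists_prop]
    by_cases h : b + 1 ≤ t ∧ t ≤ T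
    · rw [if_pos h, dif_pos ⟨⟨by omega, h.2⟩, h.1⟩]
    · rw [if_neg h, dif_neg (by tauto)]

theorem measurable_history_of_measurable {π : Policy K} (hπ : ∀ t, Measurable (π t)) (μ : Means K)
    (t : ℕ) : Measurable fun e : ℕ → ℝ => history π μ e t :=
  (measurable_history (S := Unit) (π := fun _ => π) (fun t => (hπ t).comp measurable_snd) μ t).comp
    (measurable_prodMk_left (x := ()))

theorem measurable_pulledArm_of_measurable {π : Policy K} (hπ : ∀ t, Measurable (π t))
    (μ : Means K) (t : ℕ) : Measurable fun e : ℕ → ℝ => pulledArm π μ e t :=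
  (hπ t).comp (measurable_history_of_measurable hπ μ t)

end History

/-! ### Likelihood ratio of two Gaussian bandits -/

section ChangeOfMeasure

open scoped ENNReal

variable {K : ℕ}

theorem lintegral_add_gaussianReal {v : ℝ≥0} (hv : v ≠ 0) (d : ℝ) {f : ℝ → ℝ≥0∞}
    (hf : Measurable f) :
    ∫⁻ x, f (d + x) ∂gaussianReal 0 v =
      ∫⁻ x, ENNReal.ofReal (Real.exp ((d * x - d ^ 2 / 2) / v)) * f x ∂gaussianReal 0 v := by
  have h1 : ∫⁻ x, f (d + x) ∂gaussianReal 0 v = ∫⁻ x, f x ∂gaussianReal d v := by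
    have := gaussianReal_map_const_add (μ := 0) (v := v) d
    rw [zero_add] at this
    rw [← this, lintegral_map hf (by fun_prop)]
  have hw : Measurable fun x : ℝ => ENNReal.ofReal (Real.exp ((d * x - d ^ 2 / 2) / v)) := by
    fun_prop
  have hwf := hw.fun_mul hf
  rw [h1, gaussianReal_of_var_ne_zero _ hv, gaussianReal_of_var_ne_zero _ hv,
    lintegral_withDensity_eq_lintegral_mul _ (measurable_gaussianPDF _ _) hf,
    lintegral_withDensity_eq_lintegral_mul _ (measurable_gaussianPDF _ _) hwf]
  refine lintegral_congr fun x => ?_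
  simp only [Pi.mul_apply]
  rw [← mul_assoc]
  congr 1
  rw [gaussianPDF, gaussianPDF, ← ENNReal.ofReal_mul (gaussianPDFReal_nonneg _ _ _)]
  congr 1
  rw [gaussianPDFReal, gaussianPDFReal, mul_assoc _ (Real.exp _) (Real.exp _), ← Real.exp_add]
  have : (v : ℝ) ≠ 0 := by exact_mod_cast hv
  congr 2
  field_simp
  ring

variable {Ω : Type*} [MeasurableSpace Ω] {P : Measure Ω} {ε : ℕ → Ω → ℝ} {T : ℕ} {σ : ℝ≥0}

theorem measurable_history_noise {π : Policy K} (hπ : ∀ t, Measurable (π t)) (μ : Means K)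
    (hm : ∀ t ∈ Finset.Icc 1 T, Measurable (ε t)) {t : ℕ} (ht : t ≤ T) :
    Measurable fun ω => history π μ (fun t => ε t ω) t := by
  have := (measurable_history_of_measurable hπ μ t).comp (measurable_truncNoise hm)
  convert this using 2 with ω
  exact history_congr π μ fun i h1 h2 => (truncNoise_of_mem (fun t => ε t ω) h1 (h2.trans ht)).symm

theorem indepFun_history_noise {π : Policy K} (hπ : ∀ t, Measurable (π t)) (μ : Means K)
    (hm : ∀ t ∈ Finset.Icc 1 T, Measurable (ε t))
    (hi : iIndepFun (fun t : Finset.Icc 1 T => ε t) P) {t : ℕ} (ht : t < T) :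
    IndepFun (fun ω => history π μ (fun t => ε t ω) t) (ε (t + 1)) P := by
  have := (indepFun_truncNoise_tailNoise hm hi ht.le).comp
    (measurable_history_of_measurable hπ μ t) (measurable_pi_apply (t + 1))
  convert this using 1
  · funext ω
    exact history_congr π μ fun i h1 h2 => (truncNoise_of_mem (fun t => ε t ω) h1 h2).symm
  · funext ω
    simp only [Function.comp, tailNoise]
    rw [if_pos (Finset.mem_Icc.2 ⟨le_rfl, ht⟩)]

/-- The newest noise variable is independent of the history before it, so their joint law is a
product and Tonelli integrates it out first. -/
theorem lintegral_history_succ [IsProbabilityMeasure P] {π : Policy K}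
    (hπ : ∀ t, Measurable (π t)) (μ : Means K) (hε : IsGaussianNoise T σ P ε) {t : ℕ} (ht : t < T)
    {F : (Fin (t + 1) → Fin K × ℝ) → ℝ≥0∞} (hF : Measurable F) :
    ∫⁻ ω, F (history π μ (fun t => ε t ω) (t + 1)) ∂P =
      ∫⁻ ω, ∫⁻ x, F (Fin.snoc (α := fun _ => Fin K × ℝ) (history π μ (fun t => ε t ω) t)
        (pulledArm π μ (fun t => ε t ω) t, μ (pulledArm π μ (fun t => ε t ω) t) (t + 1) + x))
        ∂gaussianReal 0 (σ ^ 2) ∂P := by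
  have hH := measurable_history_noise hπ μ hε.measurable ht.le
  have hE := hε.measurable (t + 1) (Finset.mem_Icc.2 ⟨by omega, ht⟩)
  have hmap := (indepFun_iff_map_prod_eq_prod_map_map hH.aemeasurable hE.aemeasurable).1
    (indepFun_history_noise hπ μ hε.measurable hε.indep ht)
  rw [hε.law (t + 1) (Finset.mem_Icc.2 ⟨by omega, ht⟩)] at hmap
  have hG : Measurable fun p : (Fin t → Fin K × ℝ) × ℝ =>
      F (Fin.snoc (α := fun _ => Fin K × ℝ) p.1 (π t p.1, μ (π t p.1) (t + 1) + p.2)) := by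
    have hp : Measurable fun p : (Fin t → Fin K × ℝ) × ℝ => π t p.1 := (hπ t).comp measurable_fst
    exact hF.comp (measurable_snoc measurable_fst (hp.prodMk
      (((measurable_of_countable fun k => μ k (t + 1)).comp hp).add measurable_snd)))
  have h1 := lintegral_map (μ := P) hG (hH.prodMk hE)
  have : IsProbabilityMeasure (P.map fun ω => history π μ (fun t => ε t ω) t) :=
    Measure.isProbabilityMeasure_map hH.aemeasurable
  rw [hmap, lintegral_prod _ hG.aemeasurable, lintegral_map hG.lintegral_prod_right' hH] at h1
  exact h1.symm

/-- The log-likelihood ratio of a history between the Gaussian bandit with means `μ k t + D k`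
and the Gaussian bandit with means `μ k t`, with noise variance `v`. -/
noncomputable def logLik (v : ℝ) (μ : Means K) (D : Fin K → ℝ) (t : ℕ) (h : Fin t → Fin K × ℝ) :
    ℝ :=
  ∑ i : Fin t, (D (h i).1 * ((h i).2 - μ (h i).1 (i + 1)) - D (h i).1 ^ 2 / 2) / v

theorem measurable_logLik (v : ℝ) (μ : Means K) (D : Fin K → ℝ) (t : ℕ) :
    Measurable (logLik v μ D t) := by
  refine Finset.measurable_fun_sum _ fun i _ => ?_
  have h1 : Measurable fun h : Fin t → Fin K × ℝ => (h i).1 :=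
    measurable_fst.comp (measurable_pi_apply i)
  have h2 : Measurable fun h : Fin t → Fin K × ℝ => (h i).2 :=
    measurable_snd.comp (measurable_pi_apply i)
  have h3 : Measurable fun h : Fin t → Fin K × ℝ => D (h i).1 :=
    (measurable_of_countable D).comp h1
  have h4 : Measurable fun h : Fin t → Fin K × ℝ => μ (h i).1 (i + 1) :=
    (measurable_of_countable fun k => μ k (i + 1)).comp h1
  exact ((h3.mul (h2.sub h4)).sub ((h3.pow_const 2).div_const 2)).div_const v

theorem logLik_snoc (v : ℝ) (μ : Means K) (D : Fin K → ℝ) (t : ℕ) (h : Fin t → Fin K × ℝ)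
    (k : Fin K) (x : ℝ) :
    logLik v μ D (t + 1) (Fin.snoc (α := fun _ => Fin K × ℝ) h (k, μ k (t + 1) + x)) =
      logLik v μ D t h + (D k * x - D k ^ 2 / 2) / v := by
  simp [logLik, Fin.sum_univ_castSucc]

/-- The choice of the arm contributes no factor to the likelihood ratio, since it is the same
function of the history in both bandits. Each epoch contributes one Gaussian shift by `D` of the
pulled arm. -/
theorem lintegral_history_change_means [IsProbabilityMeasure P] {π : Policy K}
    (hπ : ∀ t, Measurable (π t)) (μ : Means K) (D : Fin K → ℝ) (hε : IsGaussianNoise T σ P ε)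
    (hσ : 0 < σ) {t : ℕ} (ht : t ≤ T) {F : (Fin t → Fin K × ℝ) → ℝ≥0∞} (hF : Measurable F) :
    ∫⁻ ω, F (history π (fun k t => μ k t + D k) (fun t => ε t ω) t) ∂P =
      ∫⁻ ω, ENNReal.ofReal (Real.exp (logLik (σ ^ 2) μ D t (history π μ (fun t => ε t ω) t))) *
        F (history π μ (fun t => ε t ω) t) ∂P := by
  induction t with
  | zero => simp [history, logLik]
  | succ t ih =>
    have hv : σ ^ 2 ≠ 0 := pow_ne_zero _ hσ.ne'
    have hL : Measurable fun h => ENNReal.ofReal (Real.exp (logLik (σ ^ 2) μ D (t + 1) h)) :=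
      (Real.measurable_exp.comp (measurable_logLik _ _ _ _)).ennreal_ofReal
    rw [lintegral_history_succ hπ _ hε ht hF, lintegral_history_succ hπ μ hε ht (hL.fun_mul hF)]
    have hsn : Measurable fun p : (Fin t → Fin K × ℝ) × ℝ =>
        F (Fin.snoc (α := fun _ => Fin K × ℝ) p.1
          (π t p.1, μ (π t p.1) (t + 1) + D (π t p.1) + p.2)) := by
      have hp : Measurable fun p : (Fin t → Fin K × ℝ) × ℝ => π t p.1 :=
        (hπ t).comp measurable_fst
      exact hF.comp (measurable_snoc measurable_fst (hp.prodMk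
        (((measurable_of_countable fun k => μ k (t + 1) + D k).comp hp).add measurable_snd)))
    -- The induction hypothesis is used for `F` averaged over the last noise variable, still with
    -- the shifted mean in it.
    have := ih (by omega) (hsn.lintegral_prod_right' (ν := gaussianReal 0 (σ ^ 2)))
    simp only [pulledArm]
    rw [this]
    refine lintegral_congr fun ω => ?_
    set h := history π μ (fun t => ε t ω) t
    have hf : Measurable fun x : ℝ => F (Fin.snoc (α := fun _ => Fin K × ℝ) h
        (π t h, μ (π t h) (t + 1) + x)) :=
      hF.comp (measurable_snoc measurable_const (measurable_const.prodMk
        (measurable_const.add measurable_id)))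
    have hs := lintegral_add_gaussianReal hv (D (π t h)) hf
    simp only [← add_assoc] at hs
    rw [hs, ← lintegral_const_mul _ (by fun_prop)]
    refine lintegral_congr fun x => ?_
    simp only [logLik_snoc]
    rw [Real.exp_add, ENNReal.ofReal_mul (Real.exp_pos _).le, mul_assoc]
    simp

end ChangeOfMeasure

/-! ### Change of expectation controlled by the Kullback-Leibler divergence -/

section LowerBound

variable {K : ℕ} {Ω : Type*} [MeasurableSpace Ω] {P : Measure Ω} {ε : ℕ → Ω → ℝ} {T : ℕ}
  {σ : ℝ≥0}

/-- A pointwise substitute for Pinsker's inequality. The increment `f (e^x - 1)` is at most `B`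
times the positive part of `e^x - 1`, that is `B ((e^x - 1) + |e^x - 1|) / 2`. With `r = e^{x/2}`,
`|r² - 1| = |r - 1| (r + 1)` is split by the AM-GM inequality, and `(r - 1)² ≤ r² - 1 - x` follows
from `r ≥ 1 + x/2`. For a log-likelihood ratio `x` each term has an explicit expectation. -/
theorem exp_mul_le_add_of_mem_Icc {x f B : ℝ} (h0 : 0 ≤ f) (hB : f ≤ B) :
    Real.exp x * f ≤ f + B * ((Real.exp x - 1) / 2 + 2 * (Real.exp x - 1 - x) +
      (Real.exp x + 1) / 16) := by
  have hr : Real.exp x = Real.exp (x / 2) ^ 2 := by rw [← Real.exp_nat_mul]; ring_nf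
  have h1 : x / 2 + 1 ≤ Real.exp (x / 2) := Real.add_one_le_exp _
  rw [hr]
  set r := Real.exp (x / 2)
  have hr0 : 0 < r := Real.exp_pos _
  -- The squares with factor `8` are AM-GM for `8 (r - 1)` and `r + 1`, one sign for each sign of
  -- `r² - 1`.
  have hq : r ^ 2 - 1 ≤ (r ^ 2 - 1) / 2 + 2 * (r ^ 2 - 1 - x) + (r ^ 2 + 1) / 16 := by
    nlinarith [sq_nonneg (8 * (r - 1) - (r + 1)), sq_nonneg (r - 1)]
  have hq' : 0 ≤ (r ^ 2 - 1) / 2 + 2 * (r ^ 2 - 1 - x) + (r ^ 2 + 1) / 16 := by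
    nlinarith [sq_nonneg (8 * (r - 1) + (r + 1)), sq_nonneg (r - 1)]
  nlinarith [mul_le_mul_of_nonneg_left hq h0, mul_le_mul_of_nonneg_right hB hq']

theorem logLik_history (v : ℝ) (π : Policy K) (μ : Means K) (D : Fin K → ℝ) (e : ℕ → ℝ) (t : ℕ) :
    logLik v μ D t (history π μ e t) = ∑ i ∈ Finset.range t,
      (D (pulledArm π μ e i) * e (i + 1) - D (pulledArm π μ e i) ^ 2 / 2) / v := by
  rw [logLik, Finset.sum_range]
  refine Finset.sum_congr rfl fun i _ => ?_
  have : history π μ e t i = _ := history_apply π μ e i.2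
  rw [this]
  simp

theorem measurable_pulledArm_noise {π : Policy K} (hπ : ∀ t, Measurable (π t)) (μ : Means K)
    (hm : ∀ t ∈ Finset.Icc 1 T, Measurable (ε t)) {t : ℕ} (ht : t ≤ T) :
    Measurable fun ω => pulledArm π μ (fun t => ε t ω) t :=
  (hπ t).comp (measurable_history_noise hπ μ hm ht)

theorem IsGaussianNoise.integrable (hε : IsGaussianNoise T σ P ε) {t : ℕ}
    (ht : t ∈ Finset.Icc 1 T) : Integrable (ε t) P := by
  have h : Integrable id (P.map (ε t)) := by
    rw [hε.law t ht]
    exact (memLp_id_gaussianReal 1).integrable le_rfl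
  exact h.comp_measurable (hε.measurable t ht)

theorem IsGaussianNoise.integral_eq_zero (hε : IsGaussianNoise T σ P ε) {t : ℕ}
    (ht : t ∈ Finset.Icc 1 T) : ∫ ω, ε t ω ∂P = 0 := by
  have := integral_map (μ := P) (f := id) (hε.measurable t ht).aemeasurable
    measurable_id.aestronglyMeasurable
  rw [hε.law t ht] at this
  simpa using this.symm

theorem indepFun_pulledArm_noise {π : Policy K} (hπ : ∀ t, Measurable (π t)) (μ : Means K)
    (hε : IsGaussianNoise T σ P ε) {t : ℕ} (ht : t < T) (g : Fin K → ℝ) :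
    IndepFun (fun ω => g (pulledArm π μ (fun t => ε t ω) t)) (ε (t + 1)) P :=
  (indepFun_history_noise hπ μ hε.measurable hε.indep ht).comp
    ((measurable_of_countable g).comp (hπ t)) measurable_id

section Fixed

variable [IsProbabilityMeasure P]

theorem integrable_of_pulledArm {π : Policy K} (hπ : ∀ t, Measurable (π t)) (μ : Means K)
    (hm : ∀ t ∈ Finset.Icc 1 T, Measurable (ε t)) {t : ℕ} (ht : t ≤ T) (g : Fin K → ℝ) :
    Integrable (fun ω => g (pulledArm π μ (fun t => ε t ω) t)) P := by
  refine Integrable.of_bound (C := ∑ k, ‖g k‖)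
    ((measurable_of_countable g).comp (measurable_pulledArm_noise hπ μ hm ht)).aestronglyMeasurable
    (Filter.Eventually.of_forall fun ω => ?_)
  exact Finset.single_le_sum (f := fun k => ‖g k‖) (fun _ _ => norm_nonneg _) (Finset.mem_univ _)

theorem integrable_logLik {π : Policy K} (hπ : ∀ t, Measurable (π t)) (μ : Means K)
    (D : Fin K → ℝ) (hε : IsGaussianNoise T σ P ε) (v : ℝ) :
    Integrable (fun ω => logLik v μ D T (history π μ (fun t => ε t ω) T)) P := by
  simp only [logLik_history]
  refine integrable_finsetSum _ fun i hi => Integrable.div_const (Integrable.sub ?_ ?_) _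
  · have hi := Finset.mem_range.1 hi
    exact (indepFun_pulledArm_noise hπ μ hε hi D).integrable_mul
      (integrable_of_pulledArm hπ μ hε.measurable hi.le D)
      (hε.integrable (Finset.mem_Icc.2 ⟨by omega, hi⟩))
  · exact integrable_of_pulledArm hπ μ hε.measurable (Finset.mem_range.1 hi).le
      fun k => D k ^ 2 / 2

/-- For `v = σ²` this is minus the Kullback-Leibler divergence. The linear terms vanish because the
arm of an epoch is independent of the centred noise of that epoch. -/
theorem integral_logLik {π : Policy K} (hπ : ∀ t, Measurable (π t)) (μ : Means K)
    (D : Fin K → ℝ) (hε : IsGaussianNoise T σ P ε) (v : ℝ) :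
    ∫ ω, logLik v μ D T (history π μ (fun t => ε t ω) T) ∂P =
      -(∑ i ∈ Finset.range T, ∫ ω, D (pulledArm π μ (fun t => ε t ω) i) ^ 2 ∂P) / (2 * v) := by
  simp only [logLik_history]
  have hint (i) (hi : i ∈ Finset.range T) :
      Integrable (fun ω => D (pulledArm π μ (fun t => ε t ω) i) * ε (i + 1) ω) P := by
    have hi := Finset.mem_range.1 hi
    exact (indepFun_pulledArm_noise hπ μ hε hi D).integrable_mul
      (integrable_of_pulledArm hπ μ hε.measurable hi.le D)
      (hε.integrable (Finset.mem_Icc.2 ⟨by omega, hi⟩))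
  have hint2 (i) (hi : i ∈ Finset.range T) :
      Integrable (fun ω => D (pulledArm π μ (fun t => ε t ω) i) ^ 2 / 2) P :=
    integrable_of_pulledArm hπ μ hε.measurable (Finset.mem_range.1 hi).le fun k => D k ^ 2 / 2
  have hint3 (i) (hi : i ∈ Finset.range T) :
      Integrable (fun ω => (D (pulledArm π μ (fun t => ε t ω) i) * ε (i + 1) ω -
        D (pulledArm π μ (fun t => ε t ω) i) ^ 2 / 2) / v) P :=
    ((hint i hi).sub (hint2 i hi)).div_const v
  rw [integral_finsetSum _ hint3,
    ← Finset.sum_neg_distrib, Finset.sum_div]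
  refine Finset.sum_congr rfl fun i hi => ?_
  have hi' := Finset.mem_range.1 hi
  have hz : ∫ ω, D (pulledArm π μ (fun t => ε t ω) i) * ε (i + 1) ω ∂P = 0 := by
    have hmem : i + 1 ∈ Finset.Icc 1 T := Finset.mem_Icc.2 ⟨by omega, hi'⟩
    rw [(indepFun_pulledArm_noise hπ μ hε hi' D).integral_fun_mul_eq_mul_integral
      (integrable_of_pulledArm hπ μ hε.measurable hi'.le D).aestronglyMeasurable
      (hε.integrable hmem).aestronglyMeasurable, hε.integral_eq_zero hmem, mul_zero]
  rw [integral_div, integral_sub (hint i hi) (hint2 i hi), hz, integral_div]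
  ring

theorem integral_exp_logLik {π : Policy K} (hπ : ∀ t, Measurable (π t)) (μ : Means K)
    (D : Fin K → ℝ) (hε : IsGaussianNoise T σ P ε) (hσ : 0 < σ)
    {f : (Fin T → Fin K × ℝ) → ℝ} (hf : Measurable f) (h0 : ∀ h, 0 ≤ f h) :
    ∫ ω, Real.exp (logLik (σ ^ 2) μ D T (history π μ (fun t => ε t ω) T)) *
        f (history π μ (fun t => ε t ω) T) ∂P =
      ∫ ω, f (history π (fun k t => μ k t + D k) (fun t => ε t ω) T) ∂P := by
  have h1 := measurable_history_noise hπ μ hε.measurable le_rfl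
  have h2 := measurable_history_noise hπ (fun k t => μ k t + D k) hε.measurable le_rfl
  rw [integral_eq_lintegral_of_nonneg_ae, integral_eq_lintegral_of_nonneg_ae,
    lintegral_history_change_means hπ μ D hε hσ le_rfl hf.ennreal_ofReal]
  · simp only [ENNReal.ofReal_mul (Real.exp_pos _).le]
  · exact Filter.Eventually.of_forall fun ω => h0 _
  · exact (hf.comp h2).aestronglyMeasurable
  · exact Filter.Eventually.of_forall fun ω => mul_nonneg (Real.exp_pos _).le (h0 _)
  · exact ((Real.measurable_exp.comp ((measurable_logLik _ _ _ _).comp h1)).mul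
      (hf.comp h1)).aestronglyMeasurable

theorem integrable_exp_logLik {π : Policy K} (hπ : ∀ t, Measurable (π t)) (μ : Means K)
    (D : Fin K → ℝ) (hε : IsGaussianNoise T σ P ε) (hσ : 0 < σ) :
    Integrable (fun ω => Real.exp (logLik (σ ^ 2) μ D T (history π μ (fun t => ε t ω) T))) P := by
  -- The Bochner integral of a non-integrable function is `0`, whereas the change of measure with `f
  -- = 1` gives total mass `1`.
  by_contra h
  have := integral_exp_logLik hπ μ D hε hσ (f := fun _ => 1) measurable_const fun _ => zero_le_one
  simp only [mul_one] at this
  rw [integral_undef h] at this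
  simp at this

/-- A bounded statistic of the history changes its expectation by an amount that the
Kullback-Leibler divergence of the two Gaussian bandits controls. -/
theorem integral_history_change_means_le {π : Policy K} (hπ : ∀ t, Measurable (π t))
    (μ : Means K) (D : Fin K → ℝ) (hε : IsGaussianNoise T σ P ε) (hσ : 0 < σ) {B : ℝ}
    {f : (Fin T → Fin K × ℝ) → ℝ} (hf : Measurable f) (h0 : ∀ h, 0 ≤ f h) (hB : ∀ h, f h ≤ B) :
    ∫ ω, f (history π (fun k t => μ k t + D k) (fun t => ε t ω) T) ∂P ≤
      ∫ ω, f (history π μ (fun t => ε t ω) T) ∂P + B * (1 / 8 +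
        (∑ i ∈ Finset.range T, ∫ ω, D (pulledArm π μ (fun t => ε t ω) i) ^ 2 ∂P) / σ ^ 2) := by
  have hH := measurable_history_noise hπ μ hε.measurable le_rfl
  have hL := integrable_exp_logLik hπ μ D hε hσ
  have hl := integrable_logLik hπ μ D hε (σ ^ 2 : ℝ)
  have hfi : Integrable (fun ω => f (history π μ (fun t => ε t ω) T)) P :=
    Integrable.of_bound (C := B) (hf.comp hH).aestronglyMeasurable
      (Filter.Eventually.of_forall fun ω => by
        rw [Real.norm_of_nonneg (h0 _)]; exact hB _)
  have h1 := integral_exp_logLik hπ μ D hε hσ (f := fun _ => 1) measurable_const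
    fun _ => zero_le_one
  simp only [mul_one, integral_const, probReal_univ, smul_eq_mul] at h1
  have h2 := integral_logLik hπ μ D hε (σ ^ 2 : ℝ)
  rw [← integral_exp_logLik hπ μ D hε hσ hf h0]
  set l : Ω → ℝ := fun ω => logLik (σ ^ 2) μ D T (history π μ (fun t => ε t ω) T)
  have hA : Integrable (fun ω => (Real.exp (l ω) - 1) / 2) P :=
    (hL.sub (integrable_const 1)).div_const 2
  have hB' : Integrable (fun ω => 2 * (Real.exp (l ω) - 1 - l ω)) P :=
    ((hL.sub (integrable_const 1)).sub hl).const_mul 2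
  have hC : Integrable (fun ω => (Real.exp (l ω) + 1) / 16) P :=
    (hL.add (integrable_const 1)).div_const 16
  have hAB : Integrable (fun ω => (Real.exp (l ω) - 1) / 2 + 2 * (Real.exp (l ω) - 1 - l ω)) P :=
    hA.add hB'
  have hABC : Integrable (fun ω => B * ((Real.exp (l ω) - 1) / 2 + 2 * (Real.exp (l ω) - 1 - l ω) +
      (Real.exp (l ω) + 1) / 16)) P := (hAB.add hC).const_mul B
  have hL1 : Integrable (fun ω => Real.exp (l ω) - 1) P := hL.sub (integrable_const 1)
  have hle : ∫ ω, Real.exp (l ω) * f (history π μ (fun t => ε t ω) T) ∂P ≤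
      ∫ ω, (f (history π μ (fun t => ε t ω) T) + B * ((Real.exp (l ω) - 1) / 2 +
        2 * (Real.exp (l ω) - 1 - l ω) + (Real.exp (l ω) + 1) / 16)) ∂P := by
    refine integral_mono_of_nonneg
      (Filter.Eventually.of_forall fun ω => mul_nonneg (Real.exp_pos _).le (h0 _))
      (hfi.add hABC)
      (Filter.Eventually.of_forall fun ω => exp_mul_le_add_of_mem_Icc (h0 _) (hB _))
  refine hle.trans_eq ?_
  -- Since `exp l` has mean `1`, the three summands integrate to `0`, to twice the divergence, and
  -- to `1 / 8`.
  rw [integral_add hfi hABC, integral_const_mul,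
    integral_add hAB hC, integral_add hA hB', integral_div, integral_div,
    integral_const_mul, integral_sub hL1 hl,
    integral_sub hL (integrable_const 1), integral_add hL (integrable_const 1), h1, h2]
  simp only [integral_const, probReal_univ, smul_eq_mul]
  have : (σ : ℝ) ≠ 0 := by exact_mod_cast hσ.ne'
  field_simp
  ring

end Fixed

end LowerBound

/-! ### Hard instances and the lower bound -/

section LowerBound

variable {K : ℕ}

/-- The number of the epochs `1, …, T` at which arm `j` is pulled. -/
noncomputable def pullCount (π : Policy K) (μ : Means K) (T : ℕ) (j : Fin K) (e : ℕ → ℝ) : ℝ :=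
  ∑ t ∈ Finset.range T, if pulledArm π μ e t = j then 1 else 0

theorem pullCount_nonneg (π : Policy K) (μ : Means K) (T : ℕ) (j : Fin K) (e : ℕ → ℝ) :
    0 ≤ pullCount π μ T j e :=
  Finset.sum_nonneg fun _ _ => by split_ifs <;> norm_num

theorem pullCount_le (π : Policy K) (μ : Means K) (T : ℕ) (j : Fin K) (e : ℕ → ℝ) :
    pullCount π μ T j e ≤ T := by
  calc pullCount π μ T j e ≤ ∑ t ∈ Finset.range T, (1 : ℝ) :=
        Finset.sum_le_sum fun _ _ => by split_ifs <;> norm_num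
    _ = T := by simp

theorem sum_pullCount (π : Policy K) (μ : Means K) (T : ℕ) (e : ℕ → ℝ) :
    ∑ j, pullCount π μ T j e = T := by
  simp only [pullCount]
  rw [Finset.sum_comm]
  simp

theorem pullCount_truncNoise (π : Policy K) (μ : Means K) (T : ℕ) (j : Fin K) (e : ℕ → ℝ) :
    pullCount π μ T j (truncNoise T e) = pullCount π μ T j e := by
  refine Finset.sum_congr rfl fun t ht => ?_
  have := Finset.mem_range.1 ht
  rw [pulledArm_congr π μ fun i h1 h2 => truncNoise_of_mem e h1 (by omega)]

theorem measurable_pullCount {S : Type*} [MeasurableSpace S] {π : S → Policy K}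
    (hπ : ∀ t, Measurable fun x : S × (Fin t → Fin K × ℝ) => π x.1 t x.2) (μ : Means K)
    (T : ℕ) (j : Fin K) :
    Measurable fun x : S × (ℕ → ℝ) => pullCount (π x.1) μ T j x.2 :=
  Finset.measurable_fun_sum _ fun t _ =>
    (measurable_of_countable fun k : Fin K => if k = j then (1 : ℝ) else 0).comp
      (measurable_pulledArm hπ μ t)

/-- Mean rewards that are `1 / 4` at the multiples of `T₁` and `0` elsewhere. -/
noncomputable def spikeMeans (K T₁ : ℕ) : Means K := fun _ t => if T₁ ∣ t then 1 / 4 else 0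

/-- The mean rewards `spikeMeans` with a bonus `Δ` for arm `j`. -/
noncomputable def bonusMeans (T₁ : ℕ) (j : Fin K) (Δ : ℝ) : Means K :=
  fun k t => spikeMeans K T₁ k t + if k = j then Δ else 0

theorem isFixedBestPeriodic_bonusMeans {T₁ : ℕ} (hT₁ : 0 < T₁) (j : Fin K) {Δ : ℝ} (h0 : 0 ≤ Δ)
    (h1 : Δ ≤ 1 / 4) : IsFixedBestPeriodic T₁ (bonusMeans T₁ j Δ) where
  pos := hT₁
  mem_Icc k t := by
    simp only [bonusMeans, spikeMeans]
    split_ifs <;> constructor <;> linarith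
  periodic k t := by simp [bonusMeans, spikeMeans]
  best := ⟨j, fun t _ k => by
    simp only [bonusMeans, spikeMeans]
    split_ifs <;> simp_all⟩

/-- Epoch `0` carries a spike, so every period `p` carries one too and is a multiple of `T₁`. -/
theorem noSmallerPeriod_bonusMeans {T₁ : ℕ} (j : Fin K) (Δ : ℝ) :
    NoSmallerPeriod T₁ (bonusMeans T₁ j Δ) := by
  intro k p hp h
  have h0 := h 0
  simp only [bonusMeans, spikeMeans, zero_add, dvd_zero, if_true, add_left_inj] at h0
  refine Nat.le_of_dvd hp ?_
  by_contra hd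
  norm_num [hd] at h0

theorem pseudoRegret_bonusMeans (π : Policy K) (T₁ : ℕ) (j : Fin K) {Δ : ℝ} (h0 : 0 ≤ Δ)
    (T : ℕ) (e : ℕ → ℝ) : pseudoRegret π (bonusMeans T₁ j Δ) T e =
      Δ * (T - pullCount π (bonusMeans T₁ j Δ) T j e) := by
  have hs (t : ℕ) : ⨆ k, bonusMeans T₁ j Δ k t = bonusMeans T₁ j Δ j t := by
    have : Nonempty (Fin K) := ⟨j⟩
    refine le_antisymm (ciSup_le fun k => ?_) 
      (le_ciSup (f := fun k => bonusMeans T₁ j Δ k t) (Set.finite_range _).bddAbove j)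
    simp only [bonusMeans, spikeMeans]
    split_ifs <;> simp_all
  have hT : (T : ℝ) = ∑ t ∈ Finset.range T, (1 : ℝ) := by simp
  rw [pullCount, hT, ← Finset.sum_sub_distrib, Finset.mul_sum, pseudoRegret]
  refine Finset.sum_congr rfl fun t _ => ?_
  rw [hs]
  simp only [bonusMeans, spikeMeans]
  split_ifs <;> ring

variable {Ω : Type*} [MeasurableSpace Ω] {P : Measure Ω} [IsProbabilityMeasure P]
  {ε : ℕ → Ω → ℝ} {T : ℕ} {σ : ℝ≥0}

theorem integrable_pullCount {π : Policy K} (hπ : ∀ t, Measurable (π t)) (μ : Means K)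
    (hm : ∀ t ∈ Finset.Icc 1 T, Measurable (ε t)) (j : Fin K) :
    Integrable (fun ω => pullCount π μ T j fun t => ε t ω) P :=
  integrable_finsetSum _ fun _ hi =>
    integrable_of_pulledArm hπ μ hm (Finset.mem_range.1 hi).le fun k => if k = j then (1 : ℝ) else 0

/-- The two bandits differ only on pulls of `j`, so the sum of squared shifts is `Δ²` times the pull
count of `j` under the means without bonus. -/
theorem integral_pullCount_bonusMeans_le {π : Policy K} (hπ : ∀ t, Measurable (π t))
    (hε : IsGaussianNoise T σ P ε) (hσ : 0 < σ) (T₁ : ℕ) (j : Fin K) (Δ : ℝ) :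
    ∫ ω, pullCount π (bonusMeans T₁ j Δ) T j (fun t => ε t ω) ∂P ≤
      ∫ ω, pullCount π (spikeMeans K T₁) T j (fun t => ε t ω) ∂P + T * (1 / 8 +
        Δ ^ 2 * (∫ ω, pullCount π (spikeMeans K T₁) T j (fun t => ε t ω) ∂P) / σ ^ 2) := by
  let f : (Fin T → Fin K × ℝ) → ℝ := fun h => ∑ i, if (h i).1 = j then 1 else 0
  have hf : Measurable f := Finset.measurable_fun_sum _ fun i _ =>
    (measurable_of_countable fun k : Fin K => if k = j then (1 : ℝ) else 0).comp
      (measurable_fst.comp (measurable_pi_apply i))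
  have hfh (μ : Means K) (e : ℕ → ℝ) : f (history π μ e T) = pullCount π μ T j e := by
    rw [pullCount, Finset.sum_range]
    refine Finset.sum_congr rfl fun i _ => ?_
    have : history π μ e T i = _ := history_apply π μ e i.2
    rw [this]
  have h := integral_history_change_means_le (B := T) hπ (spikeMeans K T₁)
    (fun k => if k = j then Δ else 0) hε hσ hf
    (fun h => Finset.sum_nonneg fun _ _ => by split_ifs <;> norm_num)
    (fun h => by
      calc f h ≤ ∑ i : Fin T, (1 : ℝ) :=
            Finset.sum_le_sum fun _ _ => by split_ifs <;> norm_num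
        _ = T := by simp)
  simp only [hfh] at h
  have hs : ∑ i ∈ Finset.range T, ∫ ω, (if pulledArm π (spikeMeans K T₁) (fun t => ε t ω) i = j
      then Δ else 0) ^ 2 ∂P =
      Δ ^ 2 * ∫ ω, pullCount π (spikeMeans K T₁) T j (fun t => ε t ω) ∂P := by
    simp only [pullCount]
    rw [integral_finsetSum _ fun i hi => integrable_of_pulledArm hπ _ hε.measurable
      (Finset.mem_range.1 hi).le fun k => if k = j then (1 : ℝ) else 0, Finset.mul_sum]
    refine Finset.sum_congr rfl fun i _ => ?_
    rw [← integral_const_mul]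
    refine integral_congr_ae (Filter.Eventually.of_forall fun ω => ?_)
    simp only
    split_ifs <;> simp
  rw [hs] at h
  exact h

theorem integrable_integral_pullCount {S : Type*} [MeasurableSpace S] (ρ : Measure S)
    [IsProbabilityMeasure ρ] {π : S → Policy K}
    (hπ : ∀ t, Measurable fun x : S × (Fin t → Fin K × ℝ) => π x.1 t x.2) (μ : Means K)
    (hm : ∀ t ∈ Finset.Icc 1 T, Measurable (ε t)) (j : Fin K) :
    Integrable (fun s => ∫ ω, pullCount (π s) μ T j (fun t => ε t ω) ∂P) ρ := by
  have h1 : Measurable fun x : S × Ω => pullCount (π x.1) μ T j fun t => ε t x.2 := by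
    have := (measurable_pullCount hπ μ T j).comp
      (measurable_fst.prodMk ((measurable_truncNoise hm).comp measurable_snd))
    simpa only [Function.comp_def, pullCount_truncNoise] using this
  refine Integrable.of_bound (C := T) h1.stronglyMeasurable.integral_prod_right.aestronglyMeasurable
    (Filter.Eventually.of_forall fun s => ?_)
  rw [Real.norm_of_nonneg (integral_nonneg fun ω => pullCount_nonneg _ _ _ _ _)]
  calc ∫ ω, pullCount (π s) μ T j (fun t => ε t ω) ∂P ≤ ∫ ω, (T : ℝ) ∂P :=
        integral_mono_of_nonneg (Filter.Eventually.of_forall fun ω => pullCount_nonneg _ _ _ _ _)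
          (integrable_const _) (Filter.Eventually.of_forall fun ω => pullCount_le _ _ _ _ _)
    _ = T := by simp

/-- The seed `s` of the randomized policy is averaged out before `j` is chosen, so one `j` serves
all seeds. Its expected pull count with bonus is at most `T/K + T/16 + T/8 ≤ 11T/16`, which leaves
`5T/16` epochs that cost `Δ` each. -/
theorem exists_bonusMeans_le_regret {S : Type*} [MeasurableSpace S] (ρ : Measure S)
    [IsProbabilityMeasure ρ] {π : S → Policy K}
    (hπ : ∀ t, Measurable fun x : S × (Fin t → Fin K × ℝ) => π x.1 t x.2)
    (hε : IsGaussianNoise T σ P ε) (hσ : 0 < σ) (hK : 2 ≤ K) (T₁ : ℕ) {Δ : ℝ} (h0 : 0 ≤ Δ)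
    (hΔ : Δ ^ 2 * T ≤ σ ^ 2 * K / 16) :
    ∃ j, Δ * (T * (5 / 16)) ≤ ∫ s, expectedRegret (π s) (bonusMeans T₁ j Δ) T P ε ∂ρ := by
  have hπs (s : S) (t : ℕ) : Measurable (π s t) := (hπ t).comp measurable_prodMk_left
  let n (j : Fin K) (s : S) : ℝ :=
    ∫ ω, pullCount (π s) (spikeMeans K T₁) T j (fun t => ε t ω) ∂P
  have hn (j) : Integrable (n j) ρ := integrable_integral_pullCount ρ hπ _ hε.measurable j
  have hsum : ∑ j, ∫ s, n j s ∂ρ = T := by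
    rw [← integral_finsetSum _ fun j _ => hn j]
    have hs1 (s : S) : ∑ j, n j s = T := by
      rw [← integral_finsetSum _ fun j _ => integrable_pullCount (hπs s) _ hε.measurable j]
      simp [sum_pullCount]
    simp [hs1]
  have hKpos : (0 : ℝ) < K := by exact_mod_cast (by omega : 0 < K)
  have hK2 : (2 : ℝ) ≤ K := by exact_mod_cast hK
  have : Nonempty (Fin K) := ⟨⟨0, by omega⟩⟩
  obtain ⟨j, -, hj⟩ : ∃ j ∈ Finset.univ, ∫ s, n j s ∂ρ ≤ (T : ℝ) / K := by
    refine Finset.exists_le_of_sum_le (Finset.univ_nonempty) ?_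
    rw [hsum]
    simp only [Finset.sum_const, Finset.card_univ, Fintype.card_fin, nsmul_eq_mul]
    rw [mul_div_cancel₀ _ hKpos.ne']
  refine ⟨j, ?_⟩
  have hreg (s) : expectedRegret (π s) (bonusMeans T₁ j Δ) T P ε = Δ * (T -
      ∫ ω, pullCount (π s) (bonusMeans T₁ j Δ) T j (fun t => ε t ω) ∂P) := by
    simp only [expectedRegret, pseudoRegret_bonusMeans _ _ _ h0]
    rw [integral_const_mul, integral_sub (integrable_const _)
      (integrable_pullCount (hπs s) _ hε.measurable j)]
    simp
  simp only [hreg]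
  have hm := integrable_integral_pullCount (P := P) ρ hπ (bonusMeans T₁ j Δ) hε.measurable j
  rw [integral_const_mul, integral_sub (integrable_const _) hm]
  refine mul_le_mul_of_nonneg_left ?_ h0
  have hle : ∫ s, ∫ ω, pullCount (π s) (bonusMeans T₁ j Δ) T j (fun t => ε t ω) ∂P ∂ρ ≤
      ∫ s, ((1 + T * Δ ^ 2 / σ ^ 2) * n j s + T / 8) ∂ρ := by
    refine integral_mono hm (((hn j).const_mul _).add (integrable_const _)) fun s => ?_
    refine (integral_pullCount_bonusMeans_le (hπs s) hε hσ T₁ j Δ).trans_eq ?_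
    simp only [n]
    ring
  rw [integral_add ((hn j).const_mul _) (integrable_const _), integral_const_mul] at hle
  simp only [integral_const, probReal_univ, smul_eq_mul, one_mul] at hle ⊢
  have hσ' : (0 : ℝ) < σ ^ 2 := by positivity
  have hT0 : (0 : ℝ) ≤ T := Nat.cast_nonneg T
  have hb : (T : ℝ) * Δ ^ 2 / σ ^ 2 ≤ K / 16 := by
    rw [div_le_iff₀ hσ']
    linarith
  have hc : (1 + T * Δ ^ 2 / σ ^ 2) * ∫ s, n j s ∂ρ ≤ (1 + K / 16) * (T / K) :=
    mul_le_mul (by linarith) hj (integral_nonneg fun s => integral_nonneg fun ω =>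
      pullCount_nonneg _ _ _ _ _) (by positivity)
  have hd : (1 + (K : ℝ) / 16) * (T / K) = T / K + T / 16 := by
    field_simp
  have he : (T : ℝ) / K ≤ T / 2 := div_le_div_of_nonneg_left hT0 two_pos hK2
  linarith

theorem exists_regret_lower_bound {S : Type*} [MeasurableSpace S] (ρ : Measure S)
    [IsProbabilityMeasure ρ] {π : S → Policy K}
    (hπ : ∀ t, Measurable fun x : S × (Fin t → Fin K × ℝ) => π x.1 t x.2)
    (hε : IsGaussianNoise T σ P ε) (hσ : 0 < σ) (hK : 2 ≤ K) (hT : K ≤ T) {T₁ : ℕ}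
    (hT₁ : 0 < T₁) :
    ∃ μ : Means K, IsFixedBestPeriodic T₁ μ ∧ NoSmallerPeriod T₁ μ ∧
      (min (σ : ℝ) 1 * (5 / 64)) * √((T : ℝ) * K) ≤ ∫ s, expectedRegret (π s) μ T P ε ∂ρ := by
  have hKpos : (0 : ℝ) < K := by exact_mod_cast (by omega : 0 < K)
  have hKT : (K : ℝ) ≤ T := by exact_mod_cast hT
  have hTpos : (0 : ℝ) < T := hKpos.trans_le hKT
  have hσ' : (0 : ℝ) < σ := by exact_mod_cast hσ
  set m : ℝ := min (σ : ℝ) 1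
  have hm0 : 0 < m := lt_min hσ' one_pos
  have hm1 : m ≤ 1 := min_le_right _ _
  have hmσ : m ≤ σ := min_le_left _ _
  set r : ℝ := √((K : ℝ) / T)
  have hr0 : 0 ≤ r := Real.sqrt_nonneg _
  have hr2 : r ^ 2 = K / T := Real.sq_sqrt (by positivity)
  have hr1 : r ≤ 1 := Real.sqrt_le_one.2 ((div_le_one hTpos).2 hKT)
  have hrT : r * T = √((T : ℝ) * K) := by
    rw [eq_comm, Real.sqrt_eq_iff_eq_sq (by positivity) (by positivity), mul_pow, hr2]
    field_simp
  -- The bonus `Δ = m r / 4`: the factor `m ≤ σ` bounds the divergence, and `m ≤ 1`, `r ≤ 1` keep `Δ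
  -- ≤ 1/4`, so that the means stay in `[0, 1]`.
  have h0 : 0 ≤ m * r / 4 := by positivity
  obtain ⟨j, hj⟩ := exists_bonusMeans_le_regret (P := P) ρ hπ hε hσ hK T₁ h0 (by
    have h1 : m ^ 2 ≤ (σ : ℝ) ^ 2 := pow_le_pow_left₀ hm0.le hmσ 2
    calc (m * r / 4) ^ 2 * T = m ^ 2 * (r ^ 2 * T) / 16 := by ring
      _ = m ^ 2 * K / 16 := by rw [hr2, div_mul_cancel₀ _ hTpos.ne']
      _ ≤ σ ^ 2 * K / 16 := by gcongr)
  refine ⟨bonusMeans T₁ j (m * r / 4), isFixedBestPeriodic_bonusMeans hT₁ j h0 ?_,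
    noSmallerPeriod_bonusMeans j _, le_of_eq_of_le ?_ hj⟩
  · nlinarith
  · rw [← hrT]
    ring

end LowerBound

/-! ### Rounds of the elimination and measurability of the policy -/

section RoundState

variable {K : ℕ} {T T₁ : ℕ} {σ : ℝ} {order : ℕ → Finset (Fin K) → List (Fin K)}

theorem IsPullOrder.length (ho : IsPullOrder order) (s : ℕ) (A : Finset (Fin K)) :
    (order s A).length = A.card := by
  rw [← List.toFinset_card_of_nodup (ho s A).1, (ho s A).2]

theorem IsPullOrder.mem_iff (ho : IsPullOrder order) {s : ℕ} {A : Finset (Fin K)} {k : Fin K} :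
    k ∈ order s A ↔ k ∈ A := by
  rw [← List.mem_toFinset, (ho s A).2]

theorem IsPullOrder.idxOf_lt (ho : IsPullOrder order) {s : ℕ} {A : Finset (Fin K)} {k : Fin K}
    (hk : k ∈ A) : (order s A).idxOf k < A.card := by
  rw [← ho.length s A]
  exact List.idxOf_lt_length_iff.2 (ho.mem_iff.2 hk)

theorem roundState_succ_fst (y : ℕ → ℝ) (r : ℕ) :
    (roundState T T₁ σ order y (r + 1)).1 = (roundState T T₁ σ order y r).1 +
      (roundState T T₁ σ order y r).2.card * roundPulls K T T₁ (r + 1) := rfl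

theorem mem_roundState_succ_snd {y : ℕ → ℝ} {r : ℕ} {k : Fin K} :
    k ∈ (roundState T T₁ σ order y (r + 1)).2 ↔ k ∈ (roundState T T₁ σ order y r).2 ∧
      ∀ k' ∈ (roundState T T₁ σ order y r).2,
        roundMean T T₁ order y (r + 1) (roundState T T₁ σ order y r).1
          (roundState T T₁ σ order y r).2 k' - (2 : ℝ)⁻¹ ^ (r + 1) * σ ≤
        roundMean T T₁ order y (r + 1) (roundState T T₁ σ order y r).1
          (roundState T T₁ σ order y r).2 k := by
  simp only [roundState, Finset.mem_filter]

theorem monotone_roundState_fst (y : ℕ → ℝ) :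
    Monotone fun r => (roundState T T₁ σ order y r).1 :=
  monotone_nat_of_le_succ fun r => by
    rw [roundState_succ_fst]
    exact Nat.le_add_right _ _

theorem block_index_lt {j c n i : ℕ} (hj : j < c) (hi : i < n) : j * n + i < c * n :=
  calc j * n + i < j * n + n := by omega
    _ = (j + 1) * n := by ring
    _ ≤ c * n := Nat.mul_le_mul_right n hj

/-- The end of round `r` acts as a stopping time: agreement of the rewards up to the end computed
from `y` alone already forces equal states. -/
theorem roundState_congr (ho : IsPullOrder order) {y y' : ℕ → ℝ} {r : ℕ}
    (h : ∀ i < (roundState T T₁ σ order y r).1, y i = y' i) :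
    roundState T T₁ σ order y' r = roundState T T₁ σ order y r := by
  induction r with
  | zero => rfl
  | succ r ih =>
    have hr := ih fun i hi => h i (hi.trans_le (monotone_roundState_fst y (Nat.le_succ r)))
    have hm : ∀ k ∈ (roundState T T₁ σ order y r).2,
        roundMean T T₁ order y' (r + 1) (roundState T T₁ σ order y r).1
          (roundState T T₁ σ order y r).2 k =
        roundMean T T₁ order y (r + 1) (roundState T T₁ σ order y r).1
          (roundState T T₁ σ order y r).2 k := by
      intro k hk
      simp only [roundMean]
      congr 1
      refine Finset.sum_congr rfl fun i hi => (h _ ?_).symm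
      rw [roundState_succ_fst, add_assoc]
      exact Nat.add_lt_add_left (block_index_lt (ho.idxOf_lt hk) (Finset.mem_range.1 hi)) _
    refine Prod.ext ?_ ?_
    · rw [roundState_succ_fst, roundState_succ_fst, hr]
    · ext k
      rw [mem_roundState_succ_snd, mem_roundState_succ_snd, hr]
      refine and_congr_right fun hk => forall₂_congr fun k' hk' => ?_
      rw [hm k hk, hm k' hk']

theorem roundState_snd_nonempty [NeZero K] (hσ : 0 ≤ σ) (y : ℕ → ℝ) (r : ℕ) :
    (roundState T T₁ σ order y r).2.Nonempty := by
  induction r with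
  | zero => exact Finset.univ_nonempty
  | succ r ih =>
    obtain ⟨k, hk, hmax⟩ := Finset.exists_max_image _ (roundMean T T₁ order y (r + 1)
      (roundState T T₁ σ order y r).1 (roundState T T₁ σ order y r).2) ih
    refine ⟨k, mem_roundState_succ_snd.2 ⟨hk, fun k' hk' => ?_⟩⟩
    have := hmax k' hk'
    have : 0 ≤ (2 : ℝ)⁻¹ ^ (r + 1) * σ := by positivity
    linarith

theorem log_round_pos (hK : 2 ≤ K) (hT : 2 ≤ T) {s : ℕ} (hs : 0 < s) :
    0 < Real.log (K * T * (s : ℝ) ^ 2) := by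
  refine Real.log_pos ?_
  have h1 : (2 : ℝ) ≤ K := by exact_mod_cast hK
  have h2 : (2 : ℝ) ≤ T := by exact_mod_cast hT
  have h3 : (1 : ℝ) ≤ (s : ℝ) ^ 2 := one_le_pow₀ (by exact_mod_cast hs)
  nlinarith [mul_le_mul h1 h2 (by norm_num) (by linarith)]

theorem roundPulls_pos (hK : 2 ≤ K) (hT : 2 ≤ T) (hT₁ : 0 < T₁) {s : ℕ} (hs : 0 < s) :
    0 < roundPulls K T T₁ s := by
  have := log_round_pos hK hT hs
  have h : (0 : ℝ) < T₁ := by exact_mod_cast hT₁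
  exact Nat.mul_pos (Nat.ceil_pos.2 (by positivity)) hT₁

theorem le_roundPulls (hT₁ : 0 < T₁) (s : ℕ) :
    (2 : ℝ) ^ (2 + 2 * s) * Real.log (K * T * (s : ℝ) ^ 2) ≤ roundPulls K T T₁ s := by
  have h : (0 : ℝ) < T₁ := by exact_mod_cast hT₁
  rw [roundPulls, Nat.cast_mul, ← div_le_iff₀ h]
  exact Nat.le_ceil _

theorem roundPulls_le (hK : 2 ≤ K) (hT : 2 ≤ T) (hT₁ : 0 < T₁) {s : ℕ} (hs : 0 < s) :
    (roundPulls K T T₁ s : ℝ) ≤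
      (2 : ℝ) ^ (2 + 2 * s) * Real.log (K * T * (s : ℝ) ^ 2) + T₁ := by
  have h : (0 : ℝ) < T₁ := by exact_mod_cast hT₁
  have := log_round_pos hK hT hs
  rw [roundPulls, Nat.cast_mul]
  have h2 := (Nat.ceil_lt_add_one (show
    0 ≤ (2 : ℝ) ^ (2 + 2 * s) * Real.log (K * T * (s : ℝ) ^ 2) / T₁ by positivity)).le
  calc _ ≤ _ := mul_le_mul_of_nonneg_right h2 h.le
    _ = _ := by field_simp

/-- Every round takes at least one epoch. For `K = T = 1` the logarithm in round `1` is `0` and that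
round is empty, which the lower bounds on `K` and `T` exclude. -/
theorem strictMono_roundState_fst [NeZero K] (hσ : 0 ≤ σ) (hK : 2 ≤ K) (hT : 2 ≤ T)
    (hT₁ : 0 < T₁) (y : ℕ → ℝ) : StrictMono fun r => (roundState T T₁ σ order y r).1 :=
  strictMono_nat_of_lt_succ fun r => by
    rw [roundState_succ_fst]
    exact Nat.lt_add_of_pos_right (Nat.mul_pos (roundState_snd_nonempty hσ y r).card_pos
      (roundPulls_pos hK hT hT₁ r.succ_pos))

/-- The zeros that the policy substitutes for unseen rewards are harmless: the state at the start of
the current round reads observed rewards only. -/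
theorem seqElim_apply [NeZero K] (ho : IsPullOrder order) {t r : ℕ} {h : Fin t → Fin K × ℝ}
    {y : ℕ → ℝ} (hy : ∀ i : Fin t, (h i).2 = y i) (hr : (roundState T T₁ σ order y r).1 ≤ t)
    (hr' : t < (roundState T T₁ σ order y (r + 1)).1) :
    seqElim T T₁ σ order t h = (order (r + 1) (roundState T T₁ σ order y r).2).getD
      ((t - (roundState T T₁ σ order y r).1) / roundPulls K T T₁ (r + 1)) 0 := by
  classical
  set y' : ℕ → ℝ := fun i => if hi : i < t then (h ⟨i, hi⟩).2 else 0
  have hyy : ∀ i < (roundState T T₁ σ order y r).1, y i = y' i := fun i hi => by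
    simp only [y', dif_pos (hi.trans_le hr), hy]
  have hst := roundState_congr ho hyy
  have hst1 : (roundState T T₁ σ order y' (r + 1)).1 = (roundState T T₁ σ order y (r + 1)).1 := by
    rw [roundState_succ_fst, roundState_succ_fst, hst]
  have hex : ∃ r, (roundState T T₁ σ order y' r).1 ≤ t ∧
      t < (roundState T T₁ σ order y' (r + 1)).1 := ⟨r, by rwa [hst], by rwa [hst1]⟩
  -- The round containing `t` is unique, as each earlier round ends no later than round `r + 1`
  -- starts.
  have hfind : Nat.find hex = r := by
    refine (Nat.find_eq_iff hex).2 ⟨⟨by rwa [hst], by rwa [hst1]⟩, fun q hq hh => ?_⟩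
    have := monotone_roundState_fst (T := T) (T₁ := T₁) (σ := σ) (order := order) y'
      (Nat.succ_le_of_lt hq)
    simp only [Nat.succ_eq_add_one, hst] at this
    omega
  have : seqElim T T₁ σ order t h = (order (Nat.find hex + 1)
      (roundState T T₁ σ order y' (Nat.find hex)).2).getD
      ((t - (roundState T T₁ σ order y' (Nat.find hex)).1) /
        roundPulls K T T₁ (Nat.find hex + 1)) 0 := by
    rw [seqElim]
    exact dif_pos hex
  rw [this, hfind, hst]

theorem measurable_roundMean (s b : ℕ) (A : Finset (Fin K)) (k : Fin K) :
    Measurable fun y : ℕ → ℝ => roundMean T T₁ order y s b A k := by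
  simp only [roundMean]
  refine Measurable.div_const (Finset.measurable_fun_sum _ fun i _ => ?_) _
  exact measurable_pi_apply _

/-- There are countably many states. On each previous state `p` the start and active set are
constants, so the elimination rule is a finite set of inequalities between measurable functions. -/
theorem measurableSet_roundState_eq (r : ℕ) (q : ℕ × Finset (Fin K)) :
    MeasurableSet {y : ℕ → ℝ | roundState T T₁ σ order y r = q} := by
  induction r generalizing q with
  | zero => exact MeasurableSet.const ((0, Finset.univ) = q)
  | succ r ih =>
    have : {y : ℕ → ℝ | roundState T T₁ σ order y (r + 1) = q} =
        ⋃ p : ℕ × Finset (Fin K), {y | roundState T T₁ σ order y r = p} ∩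
          ({_y | p.1 + p.2.card * roundPulls K T T₁ (r + 1) = q.1} ∩
          ⋂ k, {y | k ∈ q.2 ↔ k ∈ p.2 ∧ ∀ k' ∈ p.2, roundMean T T₁ order y (r + 1) p.1 p.2 k' -
            (2 : ℝ)⁻¹ ^ (r + 1) * σ ≤ roundMean T T₁ order y (r + 1) p.1 p.2 k}) := by
      ext y
      simp only [Set.mem_ofPred_eq, Set.mem_iUnion, Set.mem_inter_iff, Set.mem_iInter]
      constructor
      · rintro rfl
        exact ⟨_, rfl, rfl, fun k => mem_roundState_succ_snd⟩
      · rintro ⟨p, rfl, h1, h2⟩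
        refine Prod.ext h1 (Finset.ext fun k => ?_)
        rw [h2 k]
        exact mem_roundState_succ_snd
    rw [this]
    refine MeasurableSet.iUnion fun p => (ih p).inter ((MeasurableSet.const _).inter
      (MeasurableSet.iInter fun k => ?_))
    have hm : MeasurableSet {y : ℕ → ℝ | ∀ k' ∈ p.2, roundMean T T₁ order y (r + 1) p.1 p.2 k' -
        (2 : ℝ)⁻¹ ^ (r + 1) * σ ≤ roundMean T T₁ order y (r + 1) p.1 p.2 k} := by
      simp only [Set.ofPred_forall]
      exact MeasurableSet.iInter fun k' => MeasurableSet.iInter fun _ =>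
        measurableSet_le ((measurable_roundMean _ _ _ _).sub_const _) (measurable_roundMean _ _ _ _)
    by_cases h1 : k ∈ q.2 <;> by_cases h2 : k ∈ p.2
    · simpa [h1, h2] using hm
    · simp [h1, h2]
    · convert hm.compl using 1
      ext y
      simp [h1, h2]
    · simp [h1, h2]

theorem measurableSet_roundState (r : ℕ) (Q : ℕ × Finset (Fin K) → Prop) :
    MeasurableSet {y : ℕ → ℝ | Q (roundState T T₁ σ order y r)} := by
  have : {y : ℕ → ℝ | Q (roundState T T₁ σ order y r)} =
      ⋃ p : {p // Q p}, {y | roundState T T₁ σ order y r = p} := by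
    ext y
    simp
  rw [this]
  exact MeasurableSet.iUnion fun p => measurableSet_roundState_eq r p.1

theorem measurable_seqElim [NeZero K] (t : ℕ) : Measurable (seqElim T T₁ σ order t) := by
  classical
  have hy : Measurable fun (h : Fin t → Fin K × ℝ) (i : ℕ) =>
      if hi : i < t then (h ⟨i, hi⟩).2 else 0 := by
    refine measurable_pi_iff.2 fun i => ?_
    by_cases hi : i < t
    · simp only [dif_pos hi]
      exact measurable_snd.comp (measurable_pi_apply _)
    · simp only [dif_neg hi]
      exact measurable_const
  let p (r : ℕ) (y : ℕ → ℝ) : Prop := (roundState T T₁ σ order y r).1 ≤ t ∧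
    t < (roundState T T₁ σ order y (r + 1)).1
  have hp (r : ℕ) : MeasurableSet {y | p r y} :=
    (measurableSet_roundState r fun q => q.1 ≤ t).inter
      (measurableSet_roundState (r + 1) fun q => t < q.1)
  let g (r : ℕ) (q : ℕ × Finset (Fin K)) : Fin K :=
    (order (r + 1) q.2).getD ((t - q.1) / roundPulls K T T₁ (r + 1)) 0
  let G (y : ℕ → ℝ) : Fin K :=
    if h : ∃ r, p r y then g (Nat.find h) (roundState T T₁ σ order y (Nat.find h)) else 0
  suffices hG : Measurable G from hG.comp hy
  refine measurable_to_countable' fun k => ?_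
  have : G ⁻¹' {k} = (⋃ r, ({y | p r y} ∩ ⋂ q : Fin r, {y | p q y}ᶜ) ∩
      {y | g r (roundState T T₁ σ order y r) = k}) ∪
      ({_y | (0 : Fin K) = k} ∩ ⋂ r, {y | p r y}ᶜ) := by
    ext y
    simp only [Set.mem_preimage, Set.mem_singleton_iff, Set.mem_union, Set.mem_iUnion,
      Set.mem_inter_iff, Set.mem_iInter, Set.mem_compl_iff, Set.mem_ofPred_eq, G]
    by_cases h : ∃ r, p r y
    · rw [dif_pos h]
      constructor
      · intro hk
        exact Or.inl ⟨Nat.find h, ⟨Nat.find_spec h, fun q => Nat.find_min h q.2⟩, hk⟩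
      · rintro (⟨r, ⟨h1, h2⟩, h3⟩ | ⟨-, h2⟩)
        · rwa [(Nat.find_eq_iff h).2 ⟨h1, fun q hq => h2 ⟨q, hq⟩⟩]
        · exact absurd h (not_exists.2 h2)
    · rw [dif_neg h]
      constructor
      · intro hk
        exact Or.inr ⟨hk, not_exists.1 h⟩
      · rintro (⟨r, ⟨h1, h2⟩, h3⟩ | ⟨hk, -⟩)
        · exact absurd ⟨r, h1⟩ h
        · exact hk
  rw [this]
  refine (MeasurableSet.iUnion fun r => ((hp r).inter (MeasurableSet.iInter fun q : Fin r =>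
    (hp q).compl)).inter ?_).union
    ((MeasurableSet.const _).inter (MeasurableSet.iInter fun r => (hp r).compl))
  exact measurableSet_roundState (order := order) r fun q => g r q = k

end RoundState

/-! ### Sums of a periodic function over windows -/

section PeriodicSums

variable {f : ℕ → ℝ} {p : ℕ}

theorem sum_range_add_of_periodic (hf : ∀ t, f (t + p) = f t) (a : ℕ) :
    ∑ i ∈ Finset.range p, f (a + i) = ∑ i ∈ Finset.range p, f i := by
  induction a with
  | zero => simp
  | succ a ih =>
    rw [← ih]
    have h1 := Finset.sum_range_succ (fun i => f (a + i)) p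
    have h2 := Finset.sum_range_succ' (fun i => f (a + i)) p
    rw [h1] at h2
    simp only [add_zero, hf] at h2
    rw [add_right_cancel h2]
    exact Finset.sum_congr rfl fun i _ => congrArg f (by ring)

theorem sum_range_mul_of_periodic (hf : ∀ t, f (t + p) = f t) (a q : ℕ) :
    ∑ i ∈ Finset.range (q * p), f (a + i) = q * ∑ i ∈ Finset.range p, f i := by
  induction q with
  | zero => simp
  | succ q ih =>
    rw [add_mul, one_mul, Finset.sum_range_add, ih]
    simp only [← add_assoc]
    rw [sum_range_add_of_periodic hf]
    push_cast
    ring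

/-- Full periods contribute exactly their average; the incomplete one has fewer than `p` terms, each
at most `1`. -/
theorem sum_range_le_of_periodic (hf : ∀ t, f (t + p) = f t) (h0 : ∀ t, 0 ≤ f t)
    (h1 : ∀ t, f t ≤ 1) (hp : 0 < p) (a m : ℕ) :
    ∑ i ∈ Finset.range m, f (a + i) ≤ m * ((∑ i ∈ Finset.range p, f i) / p) + p := by
  have hp' : (0 : ℝ) < p := by exact_mod_cast hp
  have hS : 0 ≤ (∑ i ∈ Finset.range p, f i) / p :=
    div_nonneg (Finset.sum_nonneg fun i _ => h0 i) hp'.le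
  have hm : m = m / p * p + m % p := (Nat.div_add_mod' m p).symm
  have h2 : ∑ i ∈ Finset.range m, f (a + i) =
      (m / p : ℕ) * ∑ i ∈ Finset.range p, f i +
        ∑ i ∈ Finset.range (m % p), f (a + (m / p * p + i)) := by
    conv_lhs => rw [hm]
    rw [Finset.sum_range_add, sum_range_mul_of_periodic hf]
  have h3 : ∑ i ∈ Finset.range (m % p), f (a + (m / p * p + i)) ≤ p := by
    calc _ ≤ ∑ i ∈ Finset.range (m % p), (1 : ℝ) := Finset.sum_le_sum fun i _ => h1 _
      _ = (m % p : ℕ) := by simp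
      _ ≤ p := by exact_mod_cast (Nat.mod_lt m hp).le
  have h4 : ((m / p : ℕ) : ℝ) * p ≤ m := by exact_mod_cast Nat.div_mul_le_self m p
  have h5 : ((m / p : ℕ) : ℝ) * ∑ i ∈ Finset.range p, f i =
      ((m / p : ℕ) * p) * ((∑ i ∈ Finset.range p, f i) / p) := by
    field_simp
  rw [h2, h5]
  exact add_le_add (mul_le_mul_of_nonneg_right h4 hS) h3

end PeriodicSums

/-! ### Regret of the elimination for a fixed noise realization -/

section Run

variable {K : ℕ}

/-- The rewards obtained by the policy `π`; entry `i` belongs to epoch `i + 1`. -/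
def rewardSeq (π : Policy K) (μ : Means K) (e : ℕ → ℝ) (i : ℕ) : ℝ :=
  μ (pulledArm π μ e i) (i + 1) + e (i + 1)

/-- The state of the sequential elimination after `r` rounds of its own run. -/
noncomputable def runState [NeZero K] (T T₁ : ℕ) (σ : ℝ)
    (order : ℕ → Finset (Fin K) → List (Fin K)) (μ : Means K) (e : ℕ → ℝ) (r : ℕ) :
    ℕ × Finset (Fin K) :=
  roundState T T₁ σ order (rewardSeq (seqElim T T₁ σ order) μ e) r

/-- The sum of the noise over the block of arm `k` in a round `s` that starts after `b` epochs with
the active set `A`. -/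
noncomputable def blockNoise (T T₁ : ℕ) (order : ℕ → Finset (Fin K) → List (Fin K)) (e : ℕ → ℝ) (s b : ℕ)
    (A : Finset (Fin K)) (k : Fin K) : ℝ :=
  ∑ i ∈ Finset.range (roundPulls K T T₁ s),
    e (b + (order s A).idxOf k * roundPulls K T T₁ s + i + 1)

/-- The average of the mean reward of arm `k` over a period. -/
noncomputable def phaseMean (T₁ : ℕ) (μ : Means K) (k : Fin K) : ℝ :=
  (∑ i ∈ Finset.range T₁, μ k i) / T₁

/-- In every round that is completed by epoch `T`, the average noise of every active arm is close
to that of arm `k₀`. -/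
def GoodNoise [NeZero K] (T T₁ : ℕ) (σ : ℝ) (order : ℕ → Finset (Fin K) → List (Fin K))
    (μ : Means K) (k₀ : Fin K) (e : ℕ → ℝ) : Prop :=
  ∀ r, (runState T T₁ σ order μ e (r + 1)).1 ≤ T → k₀ ∈ (runState T T₁ σ order μ e r).2 →
    ∀ k ∈ (runState T T₁ σ order μ e r).2,
      |blockNoise T T₁ order e (r + 1) (runState T T₁ σ order μ e r).1
          (runState T T₁ σ order μ e r).2 k -
        blockNoise T T₁ order e (r + 1) (runState T T₁ σ order μ e r).1
          (runState T T₁ σ order μ e r).2 k₀| ≤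
        roundPulls K T T₁ (r + 1) * ((2 : ℝ)⁻¹ ^ (r + 1) * σ)

/-- A bound for the gaps of the arms that survive `r` rounds. -/
noncomputable def gapBound (σ : ℝ) (r : ℕ) : ℝ := if r = 0 then 1 else 2 * ((2 : ℝ)⁻¹ ^ r * σ)

variable {T T₁ : ℕ} {μ : Means K}

/-- Periodicity carries optimality from `1, …, T₁` to all epochs, including `0`; residue `0` is
represented by `T₁`. -/
theorem IsFixedBestPeriodic.exists_best (hμ : IsFixedBestPeriodic T₁ μ) :
    ∃ k₀, ∀ t k, μ k t ≤ μ k₀ t := by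
  obtain ⟨k₀, h⟩ := hμ.best
  refine ⟨k₀, fun t k => ?_⟩
  have hmul (k : Fin K) (a q : ℕ) : μ k (a + q * T₁) = μ k a := by
    induction q with
    | zero => simp
    | succ q ih => rw [add_mul, one_mul, ← add_assoc, hμ.periodic, ih]
  have hmod (k : Fin K) : μ k t = μ k (t % T₁ + T₁) := by
    rw [hμ.periodic, ← hmul k (t % T₁) (t / T₁), Nat.mod_add_div']
  rw [hmod k, hmod k₀]
  rcases Nat.eq_zero_or_pos (t % T₁) with h0 | h0
  · rw [h0, zero_add]
    exact h T₁ (Finset.mem_Icc.2 ⟨hμ.pos, le_rfl⟩) k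
  · rw [hμ.periodic, hμ.periodic]
    exact h _ (Finset.mem_Icc.2 ⟨h0, (Nat.mod_lt _ hμ.pos).le⟩) k

theorem sum_gap_le (hμ : IsFixedBestPeriodic T₁ μ) {k₀ : Fin K} (hk₀ : ∀ t k, μ k t ≤ μ k₀ t)
    (k : Fin K) (a m : ℕ) : ∑ i ∈ Finset.range m, (μ k₀ (a + i) - μ k (a + i)) ≤
      m * (phaseMean T₁ μ k₀ - phaseMean T₁ μ k) + T₁ := by
  have := sum_range_le_of_periodic (f := fun t => μ k₀ t - μ k t) (p := T₁)
    (fun t => by rw [hμ.periodic, hμ.periodic]) (fun t => sub_nonneg.2 (hk₀ t k))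
    (fun t => by linarith [(hμ.mem_Icc k₀ t).2, (hμ.mem_Icc k t).1]) hμ.pos a m
  rwa [Finset.sum_sub_distrib (s := Finset.range T₁), sub_div] at this

theorem sum_gap_round (hμ : IsFixedBestPeriodic T₁ μ) (k₀ k : Fin K) (a s : ℕ) :
    ∑ i ∈ Finset.range (roundPulls K T T₁ s), (μ k₀ (a + i) - μ k (a + i)) =
      roundPulls K T T₁ s * (phaseMean T₁ μ k₀ - phaseMean T₁ μ k) := by
  have hT₁ : (T₁ : ℝ) ≠ 0 := by exact_mod_cast hμ.pos.ne'
  have := sum_range_mul_of_periodic (f := fun t => μ k₀ t - μ k t) (p := T₁)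
    (fun t => by rw [hμ.periodic, hμ.periodic]) a
    ⌈(2 : ℝ) ^ (2 + 2 * s) * Real.log (K * T * (s : ℝ) ^ 2) / T₁⌉₊
  rw [roundPulls, this, Finset.sum_sub_distrib, phaseMean, phaseMean]
  push_cast
  field_simp

variable [NeZero K] {σ : ℝ} {order : ℕ → Finset (Fin K) → List (Fin K)} {e : ℕ → ℝ}

theorem pulledArm_seqElim (ho : IsPullOrder order) {r j i : ℕ}
    (hj : j < (runState T T₁ σ order μ e r).2.card) (hi : i < roundPulls K T T₁ (r + 1)) :
    pulledArm (seqElim T T₁ σ order) μ e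
        ((runState T T₁ σ order μ e r).1 + (j * roundPulls K T T₁ (r + 1) + i)) =
      (order (r + 1) (runState T T₁ σ order μ e r).2).getD j 0 := by
  have h := seqElim_apply (T := T) (T₁ := T₁) (σ := σ) ho (r := r)
    (t := (runState T T₁ σ order μ e r).1 + (j * roundPulls K T T₁ (r + 1) + i))
    (h := history (seqElim T T₁ σ order) μ e _)
    (y := rewardSeq (seqElim T T₁ σ order) μ e)
    (fun i => by rw [show history (seqElim T T₁ σ order) μ e _ i = _ from
      history_apply _ μ e i.2]; rfl)
    (Nat.le_add_right _ _)
    (by rw [roundState_succ_fst]; exact Nat.add_lt_add_left (block_index_lt hj hi) _)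
  rw [pulledArm, h]
  change (order (r + 1) (runState T T₁ σ order μ e r).2).getD
    (((runState T T₁ σ order μ e r).1 + (j * roundPulls K T T₁ (r + 1) + i) -
      (runState T T₁ σ order μ e r).1) / roundPulls K T T₁ (r + 1)) 0 = _
  rw [Nat.add_sub_cancel_left, mul_comm j, Nat.mul_add_div (by omega),
    Nat.div_eq_of_lt hi, add_zero]

theorem pulledArm_seqElim_idxOf (ho : IsPullOrder order) {r i : ℕ} {k : Fin K}
    (hk : k ∈ (runState T T₁ σ order μ e r).2) (hi : i < roundPulls K T T₁ (r + 1)) :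
    pulledArm (seqElim T T₁ σ order) μ e ((runState T T₁ σ order μ e r).1 +
      ((order (r + 1) (runState T T₁ σ order μ e r).2).idxOf k * roundPulls K T T₁ (r + 1) + i)) =
      k := by
  rw [pulledArm_seqElim ho (ho.idxOf_lt hk) hi]
  have := List.idxOf_lt_length_iff.2 (ho.mem_iff (s := r + 1).2 hk)
  rw [List.getD_eq_getElem _ _ this, List.getElem_idxOf]

/-- This is where `n_s` being a multiple of `T₁` matters: the mean part of the average does not
depend on the phase at which the block starts. -/
theorem roundMean_runState (ho : IsPullOrder order) (hμ : IsFixedBestPeriodic T₁ μ) (hK : 2 ≤ K)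
    (hT : 2 ≤ T) {r : ℕ} {k : Fin K} (hk : k ∈ (runState T T₁ σ order μ e r).2) :
    roundMean T T₁ order (rewardSeq (seqElim T T₁ σ order) μ e) (r + 1)
        (runState T T₁ σ order μ e r).1 (runState T T₁ σ order μ e r).2 k =
      phaseMean T₁ μ k + blockNoise T T₁ order e (r + 1) (runState T T₁ σ order μ e r).1
        (runState T T₁ σ order μ e r).2 k / roundPulls K T T₁ (r + 1) := by
  have hn := roundPulls_pos (K := K) (T := T) hK hT hμ.pos r.succ_pos
  simp only [roundMean]
  have hsum : ∑ i ∈ Finset.range (roundPulls K T T₁ (r + 1)),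
      rewardSeq (seqElim T T₁ σ order) μ e ((runState T T₁ σ order μ e r).1 +
        (order (r + 1) (runState T T₁ σ order μ e r).2).idxOf k * roundPulls K T T₁ (r + 1) + i) =
      ∑ i ∈ Finset.range (roundPulls K T T₁ (r + 1)), μ k ((runState T T₁ σ order μ e r).1 +
        (order (r + 1) (runState T T₁ σ order μ e r).2).idxOf k * roundPulls K T T₁ (r + 1) + 1 +
          i) + blockNoise T T₁ order e (r + 1) (runState T T₁ σ order μ e r).1
        (runState T T₁ σ order μ e r).2 k := by
    rw [blockNoise, ← Finset.sum_add_distrib]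
    refine Finset.sum_congr rfl fun i hi => ?_
    have := pulledArm_seqElim_idxOf ho hk (Finset.mem_range.1 hi)
    rw [rewardSeq, add_assoc (runState T T₁ σ order μ e r).1, this, add_right_comm _ 1 i, ← add_assoc]
  have hn' : (roundPulls K T T₁ (r + 1) : ℝ) ≠ 0 := by exact_mod_cast hn.ne'
  have hT₁ : (T₁ : ℝ) ≠ 0 := by exact_mod_cast hμ.pos.ne'
  have hper (a : ℕ) : ∑ i ∈ Finset.range (roundPulls K T T₁ (r + 1)), μ k (a + i) =
      roundPulls K T T₁ (r + 1) * phaseMean T₁ μ k := by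
    rw [roundPulls, sum_range_mul_of_periodic (hμ.periodic k), phaseMean]
    push_cast
    field_simp
  rw [hsum, hper]
  field_simp

/-- With noise differences at most `2^{-s} σ`, no arm can beat `k₀` by more than the elimination
margin, so `k₀` stays. A surviving arm loses to `k₀` by at most the margin plus the noise
difference, which gives the factor `2` in `gapBound`. -/
theorem GoodNoise.gap_le {k₀ : Fin K} (hg : GoodNoise T T₁ σ order μ k₀ e)
    (ho : IsPullOrder order) (hμ : IsFixedBestPeriodic T₁ μ) (hk₀ : ∀ t k, μ k t ≤ μ k₀ t)
    (hK : 2 ≤ K) (hT : 2 ≤ T) {r : ℕ} (hr : (runState T T₁ σ order μ e r).1 ≤ T) :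
    k₀ ∈ (runState T T₁ σ order μ e r).2 ∧ ∀ k ∈ (runState T T₁ σ order μ e r).2,
      phaseMean T₁ μ k₀ - phaseMean T₁ μ k ≤ gapBound σ r := by
  have hT₁ : (0 : ℝ) < T₁ := by exact_mod_cast hμ.pos
  have hmono (k) : phaseMean T₁ μ k ≤ phaseMean T₁ μ k₀ :=
    div_le_div_of_nonneg_right (Finset.sum_le_sum fun i _ => hk₀ i k) hT₁.le
  induction r with
  | zero =>
    refine ⟨Finset.mem_univ _, fun k _ => ?_⟩
    have h1 : phaseMean T₁ μ k₀ ≤ 1 := by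
      rw [phaseMean, div_le_one hT₁]
      calc _ ≤ ∑ i ∈ Finset.range T₁, (1 : ℝ) :=
            Finset.sum_le_sum fun i _ => (hμ.mem_Icc k₀ i).2
        _ = T₁ := by simp
    have h0 : 0 ≤ phaseMean T₁ μ k :=
      div_nonneg (Finset.sum_nonneg fun i _ => (hμ.mem_Icc k i).1) hT₁.le
    simp only [gapBound, if_true]
    linarith
  | succ r ih =>
    have hr' : (runState T T₁ σ order μ e r).1 ≤ T :=
      (monotone_roundState_fst _ (Nat.le_succ r)).trans hr
    obtain ⟨hbest, -⟩ := ih hr'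
    have hn : (0 : ℝ) < roundPulls K T T₁ (r + 1) := by
      exact_mod_cast roundPulls_pos (K := K) (T := T) hK hT hμ.pos r.succ_pos
    have hdiff (k) (hk : k ∈ (runState T T₁ σ order μ e r).2) := hg r hr hbest k hk
    have hdiv (k) (hk : k ∈ (runState T T₁ σ order μ e r).2) :
        blockNoise T T₁ order e (r + 1) (runState T T₁ σ order μ e r).1
          (runState T T₁ σ order μ e r).2 k / roundPulls K T T₁ (r + 1) -
        blockNoise T T₁ order e (r + 1) (runState T T₁ σ order μ e r).1
          (runState T T₁ σ order μ e r).2 k₀ / roundPulls K T T₁ (r + 1) ≤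
        (2 : ℝ)⁻¹ ^ (r + 1) * σ := by
      rw [← sub_div, div_le_iff₀ hn, mul_comm]
      exact (le_abs_self _).trans (hdiff k hk)
    refine ⟨mem_roundState_succ_snd.2 ⟨hbest, fun k hk => ?_⟩, fun k hk => ?_⟩
    · have h1 := roundMean_runState ho hμ hK hT hk
      have h2 := roundMean_runState ho hμ hK hT hbest
      simp only [runState] at h1 h2
      rw [h1, h2]
      have := hdiv k hk
      simp only [runState] at this
      linarith [hmono k]
    · obtain ⟨hk, h⟩ := mem_roundState_succ_snd.1 hk
      have h := h k₀ hbest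
      have h1 := roundMean_runState ho hμ hK hT hk
      have h2 := roundMean_runState ho hμ hK hT hbest
      have := hdiv k hk
      simp only [runState] at h1 h2 this
      rw [h1, h2] at h
      simp only [gapBound, Nat.succ_ne_zero, if_false]
      linarith

/-- The loss of the sequential elimination at epoch `t + 1` against arm `k₀`. -/
noncomputable def epochLoss (T T₁ : ℕ) (σ : ℝ) (order : ℕ → Finset (Fin K) → List (Fin K))
    (μ : Means K) (k₀ : Fin K) (e : ℕ → ℝ) (t : ℕ) : ℝ :=
  μ k₀ (t + 1) - μ (pulledArm (seqElim T T₁ σ order) μ e t) (t + 1)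

theorem sum_epochLoss_block (ho : IsPullOrder order) (k₀ : Fin K) {r j m : ℕ}
    (hj : j < (runState T T₁ σ order μ e r).2.card) (hm : m ≤ roundPulls K T T₁ (r + 1)) :
    ∑ i ∈ Finset.range m, epochLoss T T₁ σ order μ k₀ e ((runState T T₁ σ order μ e r).1 +
      (j * roundPulls K T T₁ (r + 1) + i)) =
    ∑ i ∈ Finset.range m,
      (μ k₀ ((runState T T₁ σ order μ e r).1 + j * roundPulls K T T₁ (r + 1) + 1 + i) -
      μ ((order (r + 1) (runState T T₁ σ order μ e r).2).getD j 0)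
        ((runState T T₁ σ order μ e r).1 + j * roundPulls K T T₁ (r + 1) + 1 + i)) := by
  refine Finset.sum_congr rfl fun i hi => ?_
  rw [epochLoss, pulledArm_seqElim ho hj ((Finset.mem_range.1 hi).trans_le hm),
    add_right_comm _ 1 i, ← add_assoc (runState T T₁ σ order μ e r).1]

theorem getD_order_mem (ho : IsPullOrder order) {s j : ℕ} {A : Finset (Fin K)} (hj : j < A.card) :
    (order s A).getD j 0 ∈ A := by
  rw [← ho.length s A] at hj
  rw [List.getD_eq_getElem _ _ hj, ← ho.mem_iff (s := s)]
  exact List.getElem_mem hj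

theorem sum_epochLoss_blocks_le (ho : IsPullOrder order) (hμ : IsFixedBestPeriodic T₁ μ)
    {k₀ : Fin K} {r : ℕ} {g : ℝ} (hg : ∀ k ∈ (runState T T₁ σ order μ e r).2,
      phaseMean T₁ μ k₀ - phaseMean T₁ μ k ≤ g) {j : ℕ}
    (hj : j ≤ (runState T T₁ σ order μ e r).2.card) :
    ∑ i ∈ Finset.range (j * roundPulls K T T₁ (r + 1)),
      epochLoss T T₁ σ order μ k₀ e ((runState T T₁ σ order μ e r).1 + i) ≤
      (j * roundPulls K T T₁ (r + 1) : ℕ) * g := by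
  induction j with
  | zero => simp
  | succ j ih =>
    rw [add_mul, one_mul, Finset.sum_range_add, sum_epochLoss_block ho k₀ hj le_rfl,
      sum_gap_round hμ]
    have h1 := ih (by omega)
    have h2 := mul_le_mul_of_nonneg_left (hg _ (getD_order_mem ho (s := r + 1) hj))
      (Nat.cast_nonneg (α := ℝ) (roundPulls K T T₁ (r + 1)))
    push_cast at h1 ⊢
    linarith

/-- This treats the round interrupted at the horizon. Completed blocks consist of full periods, and
only the block in progress adds the error `T₁`. -/
theorem sum_epochLoss_le (ho : IsPullOrder order) (hμ : IsFixedBestPeriodic T₁ μ)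
    {k₀ : Fin K} (hk₀ : ∀ t k, μ k t ≤ μ k₀ t) {r : ℕ} {g : ℝ}
    (hg : ∀ k ∈ (runState T T₁ σ order μ e r).2, phaseMean T₁ μ k₀ - phaseMean T₁ μ k ≤ g) {m : ℕ}
    (hm : m < (runState T T₁ σ order μ e r).2.card * roundPulls K T T₁ (r + 1)) :
    ∑ i ∈ Finset.range m, epochLoss T T₁ σ order μ k₀ e ((runState T T₁ σ order μ e r).1 + i) ≤
      m * g + T₁ := by
  have hn : 0 < roundPulls K T T₁ (r + 1) := Nat.pos_of_ne_zero fun h => by simp [h] at hm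
  set n := roundPulls K T T₁ (r + 1)
  have hdm : m / n * n + m % n = m := Nat.div_add_mod' m n
  have hj : m / n < (runState T T₁ σ order μ e r).2.card := Nat.div_lt_of_lt_mul (by
    rwa [mul_comm])
  have h1 := sum_epochLoss_blocks_le ho hμ hg hj.le
  have h2 := sum_gap_le hμ hk₀ ((order (r + 1) (runState T T₁ σ order μ e r).2).getD (m / n) 0)
    ((runState T T₁ σ order μ e r).1 + m / n * n + 1) (m % n)
  rw [← sum_epochLoss_block ho k₀ hj (Nat.mod_lt m hn).le] at h2
  have h3 := mul_le_mul_of_nonneg_left (hg _ (getD_order_mem ho (s := r + 1) hj))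
    (Nat.cast_nonneg (α := ℝ) (m % n))
  have h4 : (m : ℝ) = (m / n * n : ℕ) + (m % n : ℕ) := by exact_mod_cast hdm.symm
  have h5 := Finset.sum_range_add (fun i => epochLoss T T₁ σ order μ k₀ e
    ((runState T T₁ σ order μ e r).1 + i)) (m / n * n) (m % n)
  rw [hdm] at h5
  rw [h5, h4]
  linarith

theorem GoodNoise.sum_epochLoss_rounds_le {k₀ : Fin K} (hg : GoodNoise T T₁ σ order μ k₀ e)
    (ho : IsPullOrder order) (hμ : IsFixedBestPeriodic T₁ μ) (hk₀ : ∀ t k, μ k t ≤ μ k₀ t)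
    (hK : 2 ≤ K) (hT : 2 ≤ T) {r : ℕ} (hr : (runState T T₁ σ order μ e r).1 ≤ T) :
    ∑ t ∈ Finset.range (runState T T₁ σ order μ e r).1, epochLoss T T₁ σ order μ k₀ e t ≤
      ∑ s ∈ Finset.range r, (((runState T T₁ σ order μ e (s + 1)).1 : ℝ) -
        (runState T T₁ σ order μ e s).1) * gapBound σ s := by
  induction r with
  | zero => simp [runState, roundState]
  | succ r ih =>
    have hsucc : (runState T T₁ σ order μ e (r + 1)).1 = (runState T T₁ σ order μ e r).1 +
      (runState T T₁ σ order μ e r).2.card * roundPulls K T T₁ (r + 1) := rfl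
    have hr' : (runState T T₁ σ order μ e r).1 ≤ T := by omega
    rw [Finset.sum_range_succ]
    have h1 := sum_epochLoss_blocks_le ho hμ (hg.gap_le ho hμ hk₀ hK hT hr').2 le_rfl
    have h2 := ih hr'
    rw [hsucc, Finset.sum_range_add]
    push_cast at h1 ⊢
    linarith

theorem GoodNoise.exists_pseudoRegret_le {k₀ : Fin K} (hg : GoodNoise T T₁ σ order μ k₀ e)
    (ho : IsPullOrder order) (hμ : IsFixedBestPeriodic T₁ μ) (hk₀ : ∀ t k, μ k t ≤ μ k₀ t)
    (hσ : 0 ≤ σ) (hK : 2 ≤ K) (hT : 2 ≤ T) :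
    ∃ (N : ℕ) (w : ℕ → ℝ), (∀ r ∈ Finset.range N, 0 ≤ w r) ∧ ∑ r ∈ Finset.range N, w r ≤ T ∧
      (∀ r ∈ Finset.range N, w r ≤ K * roundPulls K T T₁ (r + 1)) ∧
      pseudoRegret (seqElim T T₁ σ order) μ T e ≤
        ∑ r ∈ Finset.range N, w r * gapBound σ r + T₁ := by
  classical
  have hsm := strictMono_roundState_fst (T := T) (T₁ := T₁) (order := order) hσ hK hT hμ.pos
    (rewardSeq (seqElim T T₁ σ order) μ e)
  let b (r : ℕ) : ℕ := (runState T T₁ σ order μ e r).1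
  have hsm : StrictMono b := hsm
  have hb0 : b 0 = 0 := rfl
  have hsucc (r : ℕ) : b (r + 1) = b r +
      (runState T T₁ σ order μ e r).2.card * roundPulls K T T₁ (r + 1) := rfl
  have hex : ∃ r, T < b (r + 1) := ⟨T, (Nat.lt_succ_self T).trans_le (hsm.le_apply)⟩
  obtain ⟨R, hR, hRT⟩ : ∃ R, b R ≤ T ∧ T < b (R + 1) := by
    refine ⟨Nat.find hex, ?_, Nat.find_spec hex⟩
    rcases Nat.eq_zero_or_pos (Nat.find hex) with h | h
    · rw [h, hb0]
      omega
    · have := Nat.find_min hex (m := Nat.find hex - 1) (Nat.sub_lt h one_pos)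
      rw [show Nat.find hex - 1 + 1 = Nat.find hex from Nat.sub_add_cancel h] at this
      omega
  have hcard (r) : ((runState T T₁ σ order μ e r).2.card : ℝ) ≤ K := by
    exact_mod_cast (Finset.card_le_univ _).trans_eq (Fintype.card_fin K)
  -- `w r` is the number of epochs up to `T` that belong to round `r + 1`; round `R + 1` is the one
  -- not completed by `T`.
  refine ⟨R + 1, fun r => if r < R then (b (r + 1) : ℝ) - b r else T - b R, ?_, ?_, ?_, ?_⟩
  · intro r _
    simp only
    split_ifs with h
    · exact sub_nonneg.2 (by exact_mod_cast hsm.monotone r.le_succ)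
    · exact sub_nonneg.2 (by exact_mod_cast hR)
  · rw [Finset.sum_range_succ, if_neg (lt_irrefl R),
      Finset.sum_congr rfl fun r hr => if_pos (Finset.mem_range.1 hr),
      Finset.sum_range_sub (fun r => (b r : ℝ)), hb0]
    simp
  · intro r hr
    have hle : (b (r + 1) : ℝ) - b r ≤ K * roundPulls K T T₁ (r + 1) := by
      rw [hsucc]
      push_cast
      rw [add_sub_cancel_left]
      exact mul_le_mul_of_nonneg_right (hcard r) (Nat.cast_nonneg _)
    simp only
    split_ifs with h
    · exact hle
    · obtain rfl : r = R := by have := Finset.mem_range.1 hr; omega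
      refine le_trans ?_ hle
      have : (T : ℝ) ≤ b (r + 1) := by exact_mod_cast hRT.le
      linarith
  · have hreg : pseudoRegret (seqElim T T₁ σ order) μ T e =
        ∑ t ∈ Finset.range T, epochLoss T T₁ σ order μ k₀ e t := by
      refine Finset.sum_congr rfl fun t _ => ?_
      have : ⨆ k, μ k (t + 1) = μ k₀ (t + 1) :=
        le_antisymm (ciSup_le fun k => hk₀ _ k)
          (le_ciSup (f := fun k => μ k (t + 1)) (Set.finite_range _).bddAbove k₀)
      rw [this]
      rfl
    have hTb : b R + (T - b R) = T := Nat.add_sub_cancel' hR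
    have h1 := hg.sum_epochLoss_rounds_le ho hμ hk₀ hK hT hR
    have h2 := sum_epochLoss_le ho hμ hk₀ (hg.gap_le ho hμ hk₀ hK hT hR).2
      (m := T - b R) (by have := hsucc R; omega)
    rw [Nat.cast_sub hR] at h2
    have h3 := Finset.sum_range_add (epochLoss T T₁ σ order μ k₀ e) (b R) (T - b R)
    rw [hTb] at h3
    rw [hreg, h3, Finset.sum_range_succ]
    beta_reduce
    rw [if_neg (lt_irrefl R)]
    have h4 : ∑ r ∈ Finset.range R, (if r < R then (b (r + 1) : ℝ) - b r else T - b R) *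
        gapBound σ r = ∑ r ∈ Finset.range R, ((b (r + 1) : ℝ) - b r) * gapBound σ r :=
      Finset.sum_congr rfl fun r hr => by rw [if_pos (Finset.mem_range.1 hr)]
    rw [h4]
    linarith

end Run

/-! ### Probability of the bad noise event -/

section Concentration

variable {Ω : Type*} [MeasurableSpace Ω] {P : Measure Ω} {ε : ℕ → Ω → ℝ} {T : ℕ} {σ : ℝ≥0}

/-- Disjoint blocks make the difference a signed sum of `2 n` independent variables, indexed by `Fin
n ⊕ Fin n`; a sign change preserves the parameter. -/
theorem IsSubGaussianNoise.hasSubgaussianMGF_block_sub (hε : IsSubGaussianNoise T σ P ε)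
    {a a' n : ℕ} (ha : a + n ≤ T) (ha' : a' + n ≤ T) (hd : a + n ≤ a' ∨ a' + n ≤ a) :
    HasSubgaussianMGF (fun ω => ∑ i ∈ Finset.range n, ε (a + i + 1) ω -
      ∑ i ∈ Finset.range n, ε (a' + i + 1) ω) (2 * n * σ ^ 2) P := by
  let g : Fin n ⊕ Fin n → Finset.Icc 1 T := Sum.elim
    (fun i => ⟨a + i + 1, Finset.mem_Icc.2 ⟨by omega, by have := i.2; omega⟩⟩)
    (fun i => ⟨a' + i + 1, Finset.mem_Icc.2 ⟨by omega, by have := i.2; omega⟩⟩)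
  have hg : Function.Injective g := by
    rintro (i | i) (j | j) h <;> have h := congrArg Subtype.val h <;>
      simp only [g, Sum.elim_inl, Sum.elim_inr] at h <;> have := i.2 <;> have := j.2
    · rw [Fin.ext (by omega : (i : ℕ) = j)]
    · omega
    · omega
    · rw [Fin.ext (by omega : (i : ℕ) = j)]
  let s : Fin n ⊕ Fin n → ℝ → ℝ := Sum.elim (fun _ x => x) (fun _ x => -x)
  have hs (p) : Measurable (s p) := by
    rcases p with p | p
    · exact measurable_id
    · exact measurable_neg
  have hind := (hε.indep.precomp hg).comp s hs
  have hsub : ∀ p ∈ Finset.univ, HasSubgaussianMGF (s p ∘ ε (g p)) (σ ^ 2) P := by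
    intro p _
    have := hε.subGaussian (g p) (g p).2
    rcases p with p | p
    · exact this
    · exact this.neg
  have := HasSubgaussianMGF.sum_of_iIndepFun hind hsub
  simp only [Fintype.sum_sum_type, Finset.sum_const, Finset.card_univ, Fintype.card_sum,
    Fintype.card_fin, s, g, Sum.elim_inl, Sum.elim_inr, Function.comp,
    Finset.sum_neg_distrib, ← sub_eq_add_neg] at this
  simp only [Finset.sum_range]
  convert this using 1
  rw [nsmul_eq_mul]
  push_cast
  ring

theorem IsSubGaussianNoise.measure_lt_abs_block_sub_le (hε : IsSubGaussianNoise T σ P ε)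
    {a a' n : ℕ} (ha : a + n ≤ T) (ha' : a' + n ≤ T) (hd : a + n ≤ a' ∨ a' + n ≤ a) {x : ℝ}
    (hx : 0 ≤ x) :
    P {ω | x < |∑ i ∈ Finset.range n, ε (a + i + 1) ω -
      ∑ i ∈ Finset.range n, ε (a' + i + 1) ω|} ≤
      ENNReal.ofReal (2 * Real.exp (-x ^ 2 / (2 * (2 * n * σ ^ 2)))) := by
  have : IsProbabilityMeasure P := hε.indep.isProbabilityMeasure
  have h := hε.hasSubgaussianMGF_block_sub ha ha' hd
  have h1 := h.measure_ge_le hx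
  have h2 := h.neg.measure_ge_le hx
  rw [ENNReal.le_ofReal_iff_toReal_le (measure_ne_top _ _) (by positivity)]
  refine (measureReal_mono (μ := P) ?_).trans ((measureReal_union_le _ _).trans
    ((add_le_add h1 h2).trans_eq ?_))
  · intro ω hω
    rcases lt_abs.1 (show x < |_| from hω) with h | h
    · exact Or.inl h.le
    · exact Or.inr h.le
  · push_cast
    ring

variable {K : ℕ} {T₁ : ℕ} {order : ℕ → Finset (Fin K) → List (Fin K)}

theorem blockNoise_tailNoise (ho : IsPullOrder order) {s b : ℕ} {A : Finset (Fin K)}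
    (hA : b + A.card * roundPulls K T T₁ s ≤ T) {k : Fin K} (hk : k ∈ A) (e : ℕ → ℝ) :
    blockNoise T T₁ order (tailNoise b T e) s b A k = blockNoise T T₁ order e s b A k := by
  refine Finset.sum_congr rfl fun i hi => ?_
  have := block_index_lt (ho.idxOf_lt (s := s) hk) (Finset.mem_range.1 hi)
  rw [tailNoise, if_pos (Finset.mem_Icc.2 ⟨by omega, by omega⟩)]

theorem measurable_blockNoise (s b : ℕ) (A : Finset (Fin K)) (k : Fin K) :
    Measurable fun e => blockNoise T T₁ order e s b A k := by
  simp only [blockNoise]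
  refine Finset.measurable_fun_sum _ fun i _ => ?_
  exact measurable_pi_apply _

/-- Here `b` and `A` are deterministic. At the threshold `n 2^{-s} σ` the exponent of the tail bound
is `-n / 2^{2+2s}`, which the choice of `n_s` makes at most `-log (K T s²)`. -/
theorem IsSubGaussianNoise.measure_blockNoise_le (hε : IsSubGaussianNoise T σ P ε) (hσ : 0 < σ)
    (ho : IsPullOrder order) (hK : 2 ≤ K) (hT : 2 ≤ T) (hT₁ : 0 < T₁) {s b : ℕ} (hs : 0 < s)
    {A : Finset (Fin K)} (hA : b + A.card * roundPulls K T T₁ s ≤ T) {k k₀ : Fin K} (hk : k ∈ A)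
    (hk₀ : k₀ ∈ A) :
    P {ω | roundPulls K T T₁ s * ((2 : ℝ)⁻¹ ^ s * σ) <
      |blockNoise T T₁ order (fun t => ε t ω) s b A k -
        blockNoise T T₁ order (fun t => ε t ω) s b A k₀|} ≤
      ENNReal.ofReal (2 / (K * T * (s : ℝ) ^ 2)) := by
  have hσ' : (0 : ℝ) < σ := by exact_mod_cast hσ
  by_cases hkk : k = k₀
  · subst hkk
    have h0 : ¬ (roundPulls K T T₁ s * ((2 : ℝ)⁻¹ ^ s * σ) < 0) := not_lt.2 (by positivity)
    simp only [sub_self, abs_zero, h0]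
    simp
  have hn := roundPulls_pos (K := K) (T := T) hK hT hT₁ hs
  have hlog := le_roundPulls (K := K) (T := T) hT₁ s
  set n := roundPulls K T T₁ s
  have hn' : (0 : ℝ) < n := by exact_mod_cast hn
  set j := (order s A).idxOf k
  set j₀ := (order s A).idxOf k₀
  have hj : j < A.card := ho.idxOf_lt hk
  have hj₀ : j₀ < A.card := ho.idxOf_lt hk₀
  have hjj : j ≠ j₀ := fun h => hkk ((List.idxOf_inj (ho.mem_iff.2 hk)).1 h)
  have hle {i : ℕ} (hi : i < A.card) : b + i * n + n ≤ T := by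
    have := Nat.mul_le_mul_right n (Nat.succ_le_of_lt hi)
    rw [Nat.succ_eq_add_one, add_mul, one_mul] at this
    omega
  have hd : b + j * n + n ≤ b + j₀ * n ∨ b + j₀ * n + n ≤ b + j * n := by
    rcases lt_or_gt_of_ne hjj with h | h
    · left
      have := Nat.mul_le_mul_right n (Nat.succ_le_of_lt h)
      rw [Nat.succ_eq_add_one, add_mul, one_mul] at this
      omega
    · right
      have := Nat.mul_le_mul_right n (Nat.succ_le_of_lt h)
      rw [Nat.succ_eq_add_one, add_mul, one_mul] at this
      omega
  refine (hε.measure_lt_abs_block_sub_le (x := n * ((2 : ℝ)⁻¹ ^ s * σ)) (hle hj) (hle hj₀) hd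
    (by positivity)).trans (ENNReal.ofReal_le_ofReal ?_)
  have hK0 : (0 : ℝ) < K := by exact_mod_cast (by omega : 0 < K)
  have hT0 : (0 : ℝ) < T := by exact_mod_cast (by omega : 0 < T)
  have hs0 : (0 : ℝ) < s := by exact_mod_cast hs
  rw [div_eq_mul_inv 2]
  refine mul_le_mul_of_nonneg_left ?_ two_pos.le
  rw [← Real.exp_log (show (0 : ℝ) < (K * T * (s : ℝ) ^ 2)⁻¹ by positivity), Real.log_inv]
  refine Real.exp_le_exp.2 ?_
  have hexp : -(n * ((2 : ℝ)⁻¹ ^ s * σ)) ^ 2 / (2 * (2 * n * σ ^ 2)) =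
      -(n / (2 : ℝ) ^ (2 + 2 * s)) := by
    rw [pow_add, pow_mul', inv_pow]
    field_simp
  rw [hexp, neg_le_neg_iff, le_div_iff₀ (by positivity), mul_comm]
  exact hlog

theorem rewardSeq_congr (π : Policy K) (μ : Means K) {e e' : ℕ → ℝ} {t : ℕ}
    (h : ∀ i, 1 ≤ i → i ≤ t + 1 → e i = e' i) : rewardSeq π μ e t = rewardSeq π μ e' t := by
  rw [rewardSeq, rewardSeq, pulledArm_congr π μ fun i h1 h2 => h i h1 (by omega),
    h (t + 1) (by omega) le_rfl]

theorem measurable_rewardSeq {π : Policy K} (hπ : ∀ t, Measurable (π t)) (μ : Means K) :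
    Measurable (rewardSeq π μ) := by
  refine measurable_pi_iff.2 fun i => ?_
  exact ((measurable_of_countable fun k => μ k (i + 1)).comp
    (measurable_pulledArm_of_measurable hπ μ i)).add (measurable_pi_apply (i + 1))

/-- In round `r + 1`, which is completed by epoch `T` and in which arm `k₀` is active, the average
noise of some active arm differs much from that of `k₀`. -/
def BadRound (T T₁ : ℕ) (σ : ℝ) (order : ℕ → Finset (Fin K) → List (Fin K))
    (k₀ : Fin K) (r : ℕ) (q : ℕ × Finset (Fin K)) (e : ℕ → ℝ) : Prop :=
  ∃ k ∈ q.2, roundPulls K T T₁ (r + 1) * ((2 : ℝ)⁻¹ ^ (r + 1) * σ) <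
    |blockNoise T T₁ order e (r + 1) q.1 q.2 k - blockNoise T T₁ order e (r + 1) q.1 q.2 k₀|

theorem measurableSet_badRound {σ : ℝ} (k₀ : Fin K) (r : ℕ) (q : ℕ × Finset (Fin K)) :
    MeasurableSet {e | BadRound T T₁ σ order k₀ r q e} := by
  have : {e | BadRound T T₁ σ order k₀ r q e} = ⋃ k ∈ q.2,
      {e | roundPulls K T T₁ (r + 1) * ((2 : ℝ)⁻¹ ^ (r + 1) * σ) <
        |blockNoise T T₁ order e (r + 1) q.1 q.2 k -
          blockNoise T T₁ order e (r + 1) q.1 q.2 k₀|} := by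
    ext e
    simp [BadRound]
  rw [this]
  exact Finset.measurableSet_biUnion _ fun k _ => measurableSet_lt measurable_const
    (((measurable_blockNoise _ _ _ _).sub (measurable_blockNoise _ _ _ _)).abs)

theorem IsSubGaussianNoise.measure_badRound_le (hε : IsSubGaussianNoise T σ P ε) (hσ : 0 < σ)
    (ho : IsPullOrder order) (hK : 2 ≤ K) (hT : 2 ≤ T) (hT₁ : 0 < T₁) {r : ℕ}
    {q : ℕ × Finset (Fin K)} (hq : q.1 + q.2.card * roundPulls K T T₁ (r + 1) ≤ T) {k₀ : Fin K}
    (hk₀ : k₀ ∈ q.2) :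
    P {ω | BadRound T T₁ σ order k₀ r q fun t => ε t ω} ≤
      ENNReal.ofReal (2 / (T * ((r : ℝ) + 1) ^ 2)) := by
  have hK0 : (0 : ℝ) < K := by exact_mod_cast (by omega : 0 < K)
  have hT0 : (0 : ℝ) < T := by exact_mod_cast (by omega : 0 < T)
  have hset : {ω | BadRound T T₁ σ order k₀ r q fun t => ε t ω} = ⋃ k ∈ q.2,
      {ω | roundPulls K T T₁ (r + 1) * ((2 : ℝ)⁻¹ ^ (r + 1) * σ) <
        |blockNoise T T₁ order (fun t => ε t ω) (r + 1) q.1 q.2 k -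
          blockNoise T T₁ order (fun t => ε t ω) (r + 1) q.1 q.2 k₀|} := by
    ext ω
    simp [BadRound]
  rw [hset]
  refine (measure_biUnion_finset_le _ _).trans ((Finset.sum_le_sum fun k hk =>
    hε.measure_blockNoise_le hσ ho hK hT hT₁ r.succ_pos hq hk hk₀).trans ?_)
  rw [Finset.sum_const, nsmul_eq_mul, ← ENNReal.ofReal_natCast, ← ENNReal.ofReal_mul (by positivity)]
  refine ENNReal.ofReal_le_ofReal ?_
  have hc : (q.2.card : ℝ) ≤ K := by
    exact_mod_cast (Finset.card_le_univ _).trans_eq (Fintype.card_fin K)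
  calc (q.2.card : ℝ) * (2 / (K * T * ((r + 1 : ℕ) : ℝ) ^ 2)) ≤
        K * (2 / (K * T * ((r + 1 : ℕ) : ℝ) ^ 2)) := by gcongr
    _ = _ := by
      push_cast
      field_simp

theorem sum_inv_sq_le (N : ℕ) : ∑ r ∈ Finset.range N, 1 / ((r : ℝ) + 1) ^ 2 ≤ 2 - 1 / (N : ℝ) := by
  induction N with
  | zero => simp
  | succ N ih =>
    rw [Finset.sum_range_succ]
    rcases Nat.eq_zero_or_pos N with rfl | hN
    · norm_num
    · have hN' : (0 : ℝ) < N := by exact_mod_cast hN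
      have : 1 / ((N : ℝ) + 1) ^ 2 ≤ 1 / N - 1 / ((N + 1 : ℕ) : ℝ) := by
        push_cast
        rw [div_sub_div _ _ hN'.ne' (by positivity), div_le_div_iff₀ (by positivity) (by positivity)]
        nlinarith
      linarith

section

variable [NeZero K] {μ : Means K}

/-- The event that the state equals `q` is decided by the noise up to epoch `q.1`, as for a stopping
time. -/
theorem runState_truncNoise (ho : IsPullOrder order) {σ : ℝ} {e : ℕ → ℝ} {r : ℕ}
    {q : ℕ × Finset (Fin K)} :
    runState T T₁ σ order μ (truncNoise q.1 e) r = q ↔ runState T T₁ σ order μ e r = q := by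
  have h (i : ℕ) (hi : i < q.1) : rewardSeq (seqElim T T₁ σ order) μ (truncNoise q.1 e) i =
      rewardSeq (seqElim T T₁ σ order) μ e i :=
    rewardSeq_congr _ _ fun t h1 h2 => truncNoise_of_mem e h1 (by omega)
  constructor
  · intro hq
    rw [← hq]
    exact roundState_congr ho fun i hi => h i (by rw [← hq]; exact hi)
  · intro hq
    nth_rw 2 [← hq]
    exact roundState_congr ho fun i hi => (h i (by rw [← hq]; exact hi)).symm

theorem measurableSet_runState_eq {σ : ℝ} (r : ℕ) (q : ℕ × Finset (Fin K)) :
    MeasurableSet {e | runState T T₁ σ order μ e r = q} :=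
  measurable_rewardSeq measurable_seqElim μ (measurableSet_roundState_eq r q)

theorem IsSubGaussianNoise.measure_runState_inter_badRound (hε : IsSubGaussianNoise T σ P ε)
    (ho : IsPullOrder order) {r : ℕ} {q : ℕ × Finset (Fin K)}
    (hq : q.1 + q.2.card * roundPulls K T T₁ (r + 1) ≤ T) {k₀ : Fin K} (hk₀ : k₀ ∈ q.2) :
    P ({ω | runState T T₁ σ order μ (fun t => ε t ω) r = q} ∩
        {ω | BadRound T T₁ σ order k₀ r q fun t => ε t ω}) =
      P {ω | runState T T₁ σ order μ (fun t => ε t ω) r = q} *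
        P {ω | BadRound T T₁ σ order k₀ r q fun t => ε t ω} := by
  have hbad (ω : Ω) : BadRound T T₁ σ order k₀ r q (tailNoise q.1 T fun t => ε t ω) ↔
      BadRound T T₁ σ order k₀ r q fun t => ε t ω := by
    refine exists_congr fun k => and_congr_right fun hk => ?_
    rw [blockNoise_tailNoise ho hq hk, blockNoise_tailNoise ho hq hk₀]
  have h := (indepFun_truncNoise_tailNoise hε.measurable hε.indep
    (show q.1 ≤ T by omega)).measure_inter_preimage_eq_mul _ _
    (measurableSet_runState_eq (T := T) (T₁ := T₁) (σ := σ) (order := order) (μ := μ) r q)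
    (measurableSet_badRound (T := T) (T₁ := T₁) (σ := σ) (order := order) k₀ r q)
  simpa only [Set.preimage_ofPred_eq, runState_truncNoise ho, hbad] using h

theorem IsSubGaussianNoise.measurableSet_runState (hε : IsSubGaussianNoise T σ P ε)
    (ho : IsPullOrder order) {r : ℕ} {q : ℕ × Finset (Fin K)} (hq : q.1 ≤ T) :
    MeasurableSet {ω | runState T T₁ σ order μ (fun t => ε t ω) r = q} := by
  have h := measurable_truncNoise (T := q.1) (ε := ε)
    (fun t ht => hε.measurable t (Finset.Icc_subset_Icc_right hq ht))
    (measurableSet_runState_eq (T := T) (T₁ := T₁) (σ := σ) (order := order) (μ := μ) r q)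
  simpa only [Set.preimage_ofPred_eq, runState_truncNoise ho] using h

/-- Decomposition over the finitely many states `q` whose next round fits into `T` and has `k₀`
active. Each term factors by independence, and the events that the state is `q` are disjoint, so the
uniform bound for fixed `q` survives. -/
theorem IsSubGaussianNoise.measure_exists_badRound_le (hε : IsSubGaussianNoise T σ P ε)
    (hσ : 0 < σ) (ho : IsPullOrder order) (hK : 2 ≤ K) (hT : 2 ≤ T) (hT₁ : 0 < T₁) (k₀ : Fin K)
    (r : ℕ) :
    P {ω | (runState T T₁ σ order μ (fun t => ε t ω) (r + 1)).1 ≤ T ∧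
        k₀ ∈ (runState T T₁ σ order μ (fun t => ε t ω) r).2 ∧
        BadRound T T₁ σ order k₀ r (runState T T₁ σ order μ (fun t => ε t ω) r) fun t => ε t ω} ≤
      ENNReal.ofReal (2 / (T * ((r : ℝ) + 1) ^ 2)) := by
  classical
  have : IsProbabilityMeasure P := hε.indep.isProbabilityMeasure
  let Q : Finset (ℕ × Finset (Fin K)) := (Finset.range (T + 1) ×ˢ Finset.univ).filter fun q =>
    q.1 + q.2.card * roundPulls K T T₁ (r + 1) ≤ T ∧ k₀ ∈ q.2
  have hQ (q) (hq : q ∈ Q) := (Finset.mem_filter.1 hq).2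
  calc _ ≤ P (⋃ q ∈ Q, {ω | runState T T₁ σ order μ (fun t => ε t ω) r = q} ∩
        {ω | BadRound T T₁ σ order k₀ r q fun t => ε t ω}) := by
        refine measure_mono fun ω hω => ?_
        obtain ⟨h1, h2, h3⟩ := hω
        refine Set.mem_iUnion₂.2 ⟨_, Finset.mem_filter.2 ⟨Finset.mem_product.2
          ⟨Finset.mem_range.2 ?_, Finset.mem_univ _⟩, h1, h2⟩, rfl, h3⟩
        exact Nat.lt_succ_of_le ((monotone_roundState_fst _ (Nat.le_succ r)).trans h1)
    _ ≤ ∑ q ∈ Q, P ({ω | runState T T₁ σ order μ (fun t => ε t ω) r = q} ∩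
        {ω | BadRound T T₁ σ order k₀ r q fun t => ε t ω}) := measure_biUnion_finset_le _ _
    _ ≤ ∑ q ∈ Q, P {ω | runState T T₁ σ order μ (fun t => ε t ω) r = q} *
        ENNReal.ofReal (2 / (T * ((r : ℝ) + 1) ^ 2)) := by
        refine Finset.sum_le_sum fun q hq => ?_
        rw [hε.measure_runState_inter_badRound ho (hQ q hq).1 (hQ q hq).2]
        gcongr
        exact hε.measure_badRound_le hσ ho hK hT hT₁ (hQ q hq).1 (hQ q hq).2
    _ = P (⋃ q ∈ Q, {ω | runState T T₁ σ order μ (fun t => ε t ω) r = q}) *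
        ENNReal.ofReal (2 / (T * ((r : ℝ) + 1) ^ 2)) := by
        rw [← Finset.sum_mul, measure_biUnion_finset]
        · intro q _ q' _ hqq
          refine Set.disjoint_left.2 fun ω h h' => hqq ?_
          exact (show _ = q from h).symm.trans h'
        · intro q hq
          exact hε.measurableSet_runState ho (by have := (hQ q hq).1; omega)
    _ ≤ 1 * ENNReal.ofReal (2 / (T * ((r : ℝ) + 1) ^ 2)) := by
        gcongr
        exact prob_le_one
    _ = _ := one_mul _

theorem IsSubGaussianNoise.measure_not_goodNoise_le (hε : IsSubGaussianNoise T σ P ε)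
    (hσ : 0 < σ) (ho : IsPullOrder order) (hK : 2 ≤ K) (hT : 2 ≤ T) (hT₁ : 0 < T₁) (k₀ : Fin K) :
    P {ω | ¬ GoodNoise T T₁ σ order μ k₀ fun t => ε t ω} ≤ ENNReal.ofReal (4 / T) := by
  have hT0 : (0 : ℝ) < T := by exact_mod_cast (by omega : 0 < T)
  calc _ ≤ P (⋃ r ∈ Finset.range T, {ω |
        (runState T T₁ σ order μ (fun t => ε t ω) (r + 1)).1 ≤ T ∧
        k₀ ∈ (runState T T₁ σ order μ (fun t => ε t ω) r).2 ∧
        BadRound T T₁ σ order k₀ r (runState T T₁ σ order μ (fun t => ε t ω) r)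
          fun t => ε t ω}) := by
        refine measure_mono fun ω hω => ?_
        have hω : ¬ GoodNoise T T₁ σ order μ k₀ fun t => ε t ω := hω
        simp only [GoodNoise, not_forall, not_le] at hω
        obtain ⟨r, h1, h2, k, hk, h3⟩ := hω
        refine Set.mem_iUnion₂.2 ⟨r, Finset.mem_range.2 ?_, h1, h2, k, hk, h3⟩
        -- At least `r + 1` epochs have passed after `r + 1` rounds, so only `r < T` can occur.
        have hsm := (strictMono_roundState_fst (T := T) (T₁ := T₁) (σ := σ) (order := order)
          σ.2 hK hT hT₁ (rewardSeq (seqElim T T₁ σ order) μ fun t => ε t ω)).le_apply (x := r + 1)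
        exact Nat.lt_of_succ_le (hsm.trans h1)
    _ ≤ ∑ r ∈ Finset.range T, ENNReal.ofReal (2 / (T * ((r : ℝ) + 1) ^ 2)) :=
        (measure_biUnion_finset_le _ _).trans (Finset.sum_le_sum fun r _ =>
          hε.measure_exists_badRound_le hσ ho hK hT hT₁ k₀ r)
    _ = ENNReal.ofReal (∑ r ∈ Finset.range T, 2 / (T * ((r : ℝ) + 1) ^ 2)) :=
        (ENNReal.ofReal_sum_of_nonneg fun r _ => by positivity).symm
    _ ≤ ENNReal.ofReal (4 / T) := by
        refine ENNReal.ofReal_le_ofReal ?_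
        have h : ∑ r ∈ Finset.range T, 2 / (T * ((r : ℝ) + 1) ^ 2) =
            2 / (T : ℝ) * ∑ r ∈ Finset.range T, 1 / ((r : ℝ) + 1) ^ 2 := by
          rw [Finset.mul_sum]
          exact Finset.sum_congr rfl fun r _ => by field_simp
        have h2 : ∑ r ∈ Finset.range T, 1 / ((r : ℝ) + 1) ^ 2 ≤ 2 :=
          (sum_inv_sq_le T).trans (sub_le_self _ (by positivity))
        rw [h]
        calc 2 / (T : ℝ) * _ ≤ 2 / T * 2 := by gcongr
          _ = 4 / T := by ring

end

end Concentration

/-! ### Summation over the rounds and the upper bound -/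

section UpperBound

/-- The second bound drives the induction: if `2^N < X`, the new sum is at most `2^N + 2^N < 2 X`.
-/
theorem sum_two_pow_lt_le {X : ℝ} (hX : 0 ≤ X) (N : ℕ) :
    (∑ r ∈ Finset.range N, if (2 : ℝ) ^ r < X then (2 : ℝ) ^ r else 0) ≤ 2 * X ∧
      (∑ r ∈ Finset.range N, if (2 : ℝ) ^ r < X then (2 : ℝ) ^ r else 0) ≤ 2 ^ N := by
  induction N with
  | zero => simpa using hX
  | succ N ih =>
    rw [Finset.sum_range_succ, pow_succ]
    have := pow_pos (two_pos (α := ℝ)) N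
    split_ifs with h <;> constructor <;> linarith [ih.1, ih.2]

variable {K T T₁ : ℕ} {σ : ℝ}

/-- One bound with separate terms for three regimes: `r = 0`, where the gap bound is `1`; `2^r ≥
√(T/K)`, where `w` is kept for summation and the gap is small; and `2^r < √(T/K)`, where `w` is
replaced by the length of a full round. In that length, rounding up to a multiple of `T₁ ≤ √(T/K)`
produces the last term. -/
theorem mul_gapBound_le (hσ : 0 ≤ σ) (hK : 2 ≤ K) (hT₁ : 0 < T₁)
    (hle : (T₁ : ℝ) ≤ √((T : ℝ) / K)) {r : ℕ} {w : ℝ} (h0 : 0 ≤ w)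
    (hw : w ≤ K * roundPulls K T T₁ (r + 1)) :
    w * gapBound σ r ≤
      (if r = 0 then 32 * √((T : ℝ) * K) * Real.log T + √((T : ℝ) * K) else 0) +
      w * (2 * σ / √((T : ℝ) / K)) +
      64 * σ * K * Real.log T *
        (if (2 : ℝ) ^ r < √((T : ℝ) / K) then (2 : ℝ) ^ r else 0) +
      2 * σ * √((T : ℝ) * K) * (1 / 2) ^ r := by
  have hK0 : (0 : ℝ) < K := by exact_mod_cast (by omega : 0 < K)
  set X := √((T : ℝ) / K)
  have hX1 : 1 ≤ X := le_trans (by exact_mod_cast hT₁) hle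
  have hX2 : X ^ 2 = T / K := Real.sq_sqrt (by positivity)
  have hTX : (T : ℝ) = K * X ^ 2 := by
    rw [hX2]
    field_simp
  have hY : √((T : ℝ) * K) = K * X := by
    rw [Real.sqrt_eq_iff_eq_sq (by positivity) (by positivity), hTX]
    ring
  have hKT : (K : ℝ) ≤ T := by
    rw [hTX]
    exact le_mul_of_one_le_right hK0.le (one_le_pow₀ hX1)
  have hT2 : 2 ≤ T := hK.trans (by exact_mod_cast hKT)
  have hT0 : (0 : ℝ) < T := hK0.trans_le hKT
  have hlog : 0 ≤ Real.log T := Real.log_nonneg (by exact_mod_cast (by omega : 1 ≤ T))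
  have hn := roundPulls_le (K := K) (T := T) hK hT2 hT₁ r.succ_pos
  rw [hY]
  have hc2 : 0 ≤ w * (2 * σ / X) := by positivity
  have hc3 : 0 ≤ 64 * σ * K * Real.log T * (if (2 : ℝ) ^ r < X then (2 : ℝ) ^ r else 0) := by
    split_ifs <;> positivity
  have hc4 : 0 ≤ 2 * σ * (K * X) * (1 / 2) ^ r := by positivity
  -- For a round index `s ≤ √(T/K)` one has `K T s² ≤ T²`.
  have hlogle (h : (((r + 1 : ℕ) : ℝ)) ≤ X) :
      Real.log (K * T * ((r + 1 : ℕ) : ℝ) ^ 2) ≤ 2 * Real.log T := by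
    rw [← Real.log_rpow hT0 2]
    refine Real.log_le_log (by positivity) ?_
    calc (K : ℝ) * T * ((r + 1 : ℕ) : ℝ) ^ 2 ≤ K * T * X ^ 2 := by gcongr
      _ = (T : ℝ) ^ (2 : ℝ) := by
        rw [Real.rpow_two, sq (T : ℝ)]
        nth_rw 3 [hTX]
        ring
  rcases Nat.eq_zero_or_pos r with rfl | hr
  · have hl := hlogle (by simpa using hX1)
    have : w ≤ 32 * (K * X) * Real.log T + K * X := by
      refine hw.trans ((mul_le_mul_of_nonneg_left hn hK0.le).trans ?_)
      have h1 : (2 : ℝ) ^ (2 + 2 * (0 + 1)) * Real.log (K * T * ((0 + 1 : ℕ) : ℝ) ^ 2) ≤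
          32 * Real.log T := by
        norm_num at hl ⊢
        linarith
      have h2 : 32 * Real.log T ≤ 32 * Real.log T * X := le_mul_of_one_le_right (by positivity) hX1
      calc _ ≤ (K : ℝ) * (32 * Real.log T * X + X) :=
            mul_le_mul_of_nonneg_left (add_le_add (h1.trans h2) hle) hK0.le
        _ = _ := by ring
    rw [show gapBound σ 0 = 1 from if_pos rfl, mul_one, if_pos rfl]
    exact le_add_of_le_of_nonneg (le_add_of_le_of_nonneg (le_add_of_le_of_nonneg this hc2) hc3) hc4
  · have hg : gapBound σ r = 2 * ((2 : ℝ)⁻¹ ^ r * σ) := if_neg hr.ne'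
    have h2r : (0 : ℝ) < 2 ^ r := by positivity
    rw [hg, if_neg hr.ne', zero_add]
    by_cases h : (2 : ℝ) ^ r < X
    · rw [if_pos h] at hc3 ⊢
      have hrX : (((r + 1 : ℕ) : ℝ)) ≤ X := le_trans (by exact_mod_cast Nat.lt_two_pow_self) h.le
      have hl := hlogle hrX
      have hw' : w ≤ K * (2 ^ (2 + 2 * (r + 1)) * (2 * Real.log T) + X) :=
        hw.trans (mul_le_mul_of_nonneg_left (hn.trans (add_le_add
          (mul_le_mul_of_nonneg_left hl (by positivity)) hle)) hK0.le)
      have := mul_le_mul_of_nonneg_right hw' (show 0 ≤ 2 * ((2 : ℝ)⁻¹ ^ r * σ) by positivity)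
      have he : (K : ℝ) * (2 ^ (2 + 2 * (r + 1)) * (2 * Real.log T) + X) *
          (2 * ((2 : ℝ)⁻¹ ^ r * σ)) =
          64 * σ * K * Real.log T * 2 ^ r + 2 * σ * (K * X) * (1 / 2) ^ r := by
        have h4 : (2 : ℝ) ^ (2 + 2 * (r + 1)) = 16 * (2 ^ r) ^ 2 := by ring
        rw [h4, one_div, inv_pow]
        field_simp
        ring
      linarith
    · have : w * (2 * ((2 : ℝ)⁻¹ ^ r * σ)) ≤ w * (2 * σ / X) := by
        refine mul_le_mul_of_nonneg_left ?_ h0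
        have he : 2 * ((2 : ℝ)⁻¹ ^ r * σ) = 2 * σ / 2 ^ r := by
          rw [inv_pow]
          field_simp
        rw [he]
        exact div_le_div_of_nonneg_left (by positivity) (by linarith) (not_lt.1 h)
      linarith

theorem sum_mul_gapBound_le (hσ : 0 ≤ σ) (hK : 2 ≤ K) (hT₁ : 0 < T₁)
    (hle : (T₁ : ℝ) ≤ √((T : ℝ) / K)) {N : ℕ} {w : ℕ → ℝ} (h0 : ∀ r ∈ Finset.range N, 0 ≤ w r)
    (hsum : ∑ r ∈ Finset.range N, w r ≤ T)
    (hw : ∀ r ∈ Finset.range N, w r ≤ K * roundPulls K T T₁ (r + 1)) :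
    ∑ r ∈ Finset.range N, w r * gapBound σ r + T₁ ≤
      √((T : ℝ) * K) * ((128 * σ + 32) * Real.log T + (6 * σ + 2)) := by
  have hK0 : (0 : ℝ) < K := by exact_mod_cast (by omega : 0 < K)
  have hK1 : (1 : ℝ) ≤ K := by exact_mod_cast (by omega : 1 ≤ K)
  refine (add_le_add_left (Finset.sum_le_sum fun r hr =>
    mul_gapBound_le hσ hK hT₁ hle (h0 r hr) (hw r hr)) _).trans ?_
  set X := √((T : ℝ) / K)
  have hX1 : 1 ≤ X := le_trans (by exact_mod_cast hT₁) hle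
  have hX2 : X ^ 2 = T / K := Real.sq_sqrt (by positivity)
  have hTX : (T : ℝ) = K * X ^ 2 := by
    rw [hX2]
    field_simp
  have hY : √((T : ℝ) * K) = K * X := by
    rw [Real.sqrt_eq_iff_eq_sq (by positivity) (by positivity), hTX]
    ring
  have hT1 : (1 : ℝ) ≤ T := by
    rw [hTX]
    exact one_le_mul_of_one_le_of_one_le hK1 (one_le_pow₀ hX1)
  have hlog : 0 ≤ Real.log T := Real.log_nonneg hT1
  have hX0 : 0 < X := by linarith
  simp only [Finset.sum_add_distrib, ← Finset.mul_sum, ← Finset.sum_mul]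
  rw [hY]
  have s1 : (∑ r ∈ Finset.range N, if r = 0 then 32 * (K * X) * Real.log T + K * X else 0) ≤
      32 * (K * X) * Real.log T + K * X := by
    rw [Finset.sum_ite_eq']
    split_ifs
    · exact le_rfl
    · positivity
  have s2 : (∑ r ∈ Finset.range N, w r) * (2 * σ / X) ≤ 2 * σ * (K * X) := by
    calc _ ≤ (T : ℝ) * (2 * σ / X) := by gcongr
      _ = _ := by
        rw [hTX]
        field_simp
  have s3 := mul_le_mul_of_nonneg_left (sum_two_pow_lt_le hX0.le N).1
    (show 0 ≤ 64 * σ * K * Real.log T by positivity)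
  have s4 := mul_le_mul_of_nonneg_left (sum_geometric_two_le N)
    (show 0 ≤ 2 * σ * (K * X) by positivity)
  have s5 : (T₁ : ℝ) ≤ K * X := hle.trans (le_mul_of_one_le_left hX0.le hK1)
  linarith

theorem pseudoRegret_mem_Icc [NeZero K] {μ : Means K} (hμ : IsFixedBestPeriodic T₁ μ)
    (π : Policy K) (e : ℕ → ℝ) : pseudoRegret π μ T e ∈ Set.Icc (0 : ℝ) T := by
  have hb (t : ℕ) : BddAbove (Set.range fun k => μ k t) := (Set.finite_range _).bddAbove
  constructor
  · exact Finset.sum_nonneg fun t _ => sub_nonneg.2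
      (le_ciSup (f := fun k => μ k (t + 1)) (hb _) _)
  · calc pseudoRegret π μ T e ≤ ∑ t ∈ Finset.range T, (1 : ℝ) := Finset.sum_le_sum fun t _ => by
          have h1 : ⨆ k, μ k (t + 1) ≤ 1 := ciSup_le fun k => (hμ.mem_Icc k _).2
          linarith [(hμ.mem_Icc (pulledArm π μ e t) (t + 1)).1]
      _ = T := by simp

theorem expectedRegret_seqElim_le [NeZero K] {σ : ℝ≥0} (hσ : 0 < σ)
    {order : ℕ → Finset (Fin K) → List (Fin K)} {μ : Means K} {Ω : Type*} [MeasurableSpace Ω]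
    {P : Measure Ω} [IsProbabilityMeasure P] {ε : ℕ → Ω → ℝ} (ho : IsPullOrder order)
    (hμ : IsFixedBestPeriodic T₁ μ) (hε : IsSubGaussianNoise T σ P ε)
    (hle : (T₁ : ℝ) ≤ √((T : ℝ) / K)) :
    expectedRegret (seqElim T T₁ σ order) μ T P ε ≤
      (134 * σ + 38) * √((T : ℝ) * K) * (1 + Real.log T) := by
  have hσ0 : (0 : ℝ) < σ := by exact_mod_cast hσ
  have hK0 : 0 < K := Nat.pos_of_ne_zero (NeZero.ne K)
  have hK0' : (0 : ℝ) < K := by exact_mod_cast hK0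
  have hTK : (1 : ℝ) ≤ T / K :=
    Real.one_le_sqrt.1 (le_trans (by exact_mod_cast hμ.pos) hle)
  rw [one_le_div hK0'] at hTK
  have hKT : K ≤ T := by exact_mod_cast hTK
  have hT1 : (1 : ℝ) ≤ T := by exact_mod_cast (by omega : 1 ≤ T)
  have hlog : 0 ≤ Real.log T := Real.log_nonneg hT1
  obtain ⟨k₀, hk₀⟩ := hμ.exists_best
  -- A single arm has no regret; otherwise `T ≥ K ≥ 2` and all rounds are nonempty.
  rcases Nat.lt_or_ge K 2 with hK | hK
  · obtain rfl : K = 1 := by omega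
    have h0 (e : ℕ → ℝ) : pseudoRegret (seqElim T T₁ σ order) μ T e = 0 := by
      refine Finset.sum_eq_zero fun t _ => ?_
      rw [ciSup_unique, Subsingleton.elim (pulledArm _ μ e t) default, sub_self]
    simp only [expectedRegret, h0, integral_zero]
    positivity
  have hT2 : 2 ≤ T := hK.trans hKT
  set B : ℝ := √((T : ℝ) * K) * ((128 * σ + 32) * Real.log T + (6 * σ + 2))
  have hB : 0 ≤ B := by positivity
  -- The measurable hull has the same measure and makes the indicator integrable without a proof
  -- that the bad event is measurable.
  set bad : Set Ω := toMeasurable P {ω | ¬ GoodNoise T T₁ σ order μ k₀ fun t => ε t ω}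
  have hbadm : MeasurableSet bad := measurableSet_toMeasurable _ _
  have hbad : P.real bad ≤ 4 / T := by
    refine ENNReal.toReal_le_of_le_ofReal (by positivity) ?_
    rw [measure_toMeasurable]
    exact hε.measure_not_goodNoise_le hσ ho hK hT2 hμ.pos k₀
  have hpt (ω : Ω) : pseudoRegret (seqElim T T₁ σ order) μ T (fun t => ε t ω) ≤
      B + bad.indicator (fun _ => (T : ℝ)) ω := by
    by_cases hω : ω ∈ bad
    · rw [Set.indicator_of_mem hω]
      linarith [(pseudoRegret_mem_Icc (T := T) hμ (seqElim T T₁ σ order) fun t => ε t ω).2]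
    · rw [Set.indicator_of_notMem hω, add_zero]
      have hg : GoodNoise T T₁ σ order μ k₀ fun t => ε t ω := by
        by_contra h
        exact hω (subset_toMeasurable _ _ h)
      obtain ⟨N, w, h1, h2, h3, h4⟩ := hg.exists_pseudoRegret_le ho hμ hk₀ hσ0.le hK hT2
      exact h4.trans (sum_mul_gapBound_le hσ0.le hK hμ.pos hle h1 h2 h3)
  have hint : expectedRegret (seqElim T T₁ σ order) μ T P ε ≤ B + P.real bad * T := by
    calc _ ≤ ∫ ω, (B + bad.indicator (fun _ => (T : ℝ)) ω) ∂P :=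
          integral_mono_of_nonneg
            (Filter.Eventually.of_forall fun ω => (pseudoRegret_mem_Icc hμ _ _).1)
            ((integrable_const _).add ((integrable_const _).indicator hbadm))
            (Filter.Eventually.of_forall hpt)
      _ = _ := by
          rw [integral_add (integrable_const _) ((integrable_const _).indicator hbadm),
            integral_indicator_const _ hbadm]
          simp
  have hY : 1 ≤ √((T : ℝ) * K) := Real.one_le_sqrt.2
    (one_le_mul_of_one_le_of_one_le hT1 (by exact_mod_cast hK0))
  have hbT : P.real bad * T ≤ 4 := by
    rwa [← le_div_iff₀ (by linarith)]
  have hfin : B + 4 * √((T : ℝ) * K) ≤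
      (134 * σ + 38) * √((T : ℝ) * K) * (1 + Real.log T) := by
    have : 0 ≤ √((T : ℝ) * K) * ((6 * σ + 6) * Real.log T + (128 * σ + 32)) := by positivity
    simp only [B]
    linarith
  linarith

end UpperBound

end PeriodicBandit

theorem mainTheorem4 (σ : ℝ≥0) (hσ : 0 < σ) :
    -- upper bound for the sequential-elimination policy
    (∃ C : ℝ, 0 < C ∧
      ∀ (K : ℕ) [NeZero K] (T T₁ : ℕ) (order : ℕ → Finset (Fin K) → List (Fin K))
        (μ : PeriodicBandit.Means K)
        (Ω : Type*) [MeasurableSpace Ω] (P : Measure Ω) [IsProbabilityMeasure P] (ε : ℕ → Ω → ℝ),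
        PeriodicBandit.IsPullOrder order →
        PeriodicBandit.IsFixedBestPeriodic T₁ μ →
        PeriodicBandit.IsSubGaussianNoise T σ P ε →
        (T₁ : ℝ) ≤ √((T : ℝ) / K) →
        (∀ t, Measurable (PeriodicBandit.seqElim T T₁ σ order t)) ∧
        PeriodicBandit.expectedRegret (PeriodicBandit.seqElim T T₁ σ order) μ T P ε
          ≤ C * √((T : ℝ) * K) * (1 + Real.log T)) ∧
    -- lower bound for every (possibly randomized) policy, already for Gaussian noise
    (∃ c : ℝ, 0 < c ∧
      ∀ (K T T₁ : ℕ), 2 ≤ K → K ≤ T → 0 < T₁ →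
      ∀ (S : Type*) [MeasurableSpace S] (ρ : Measure S) [IsProbabilityMeasure ρ]
        (π : S → PeriodicBandit.Policy K),
        (∀ t, Measurable fun x : S × (Fin t → Fin K × ℝ) => π x.1 t x.2) →
      ∀ (Ω : Type*) [MeasurableSpace Ω] (P : Measure Ω) [IsProbabilityMeasure P] (ε : ℕ → Ω → ℝ),
        PeriodicBandit.IsGaussianNoise T σ P ε →
        ∃ μ : PeriodicBandit.Means K,
          PeriodicBandit.IsFixedBestPeriodic T₁ μ ∧ PeriodicBandit.NoSmallerPeriod T₁ μ ∧
          c * √((T : ℝ) * K) ≤ ∫ s, PeriodicBandit.expectedRegret (π s) μ T P ε ∂ρ) := by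
  refine ⟨⟨134 * σ + 38, by positivity, ?_⟩, ⟨min (σ : ℝ) 1 * (5 / 64), ?_, ?_⟩⟩
  · intro K _ T T₁ order μ Ω _ P _ ε ho hμ hε hle
    exact ⟨fun t => PeriodicBandit.measurable_seqElim t,
      PeriodicBandit.expectedRegret_seqElim_le hσ ho hμ hε hle⟩
  · have : (0 : ℝ) < σ := by exact_mod_cast hσ
    positivity
  · intro K T T₁ hK hT hT₁ S _ ρ _ π hπ Ω _ P _ ε hε
    exact PeriodicBandit.exists_regret_lower_bound ρ hπ hε hσ hK hT hT₁
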